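/- Let $\mathbb{N}$ be the set of positive integers and $\mathbb{N}_0=\mathbb{N}\cup\{0\}$. Let $a,N$ be integers with $1\le a\le N$. For a (possibly empty) sequence $(s_1,\dots,s_u)$ of positive integers, with $s_1\ge 2$ if $u\ge 1$, put $$t^\star_{N,a}(s_1,\dots,s_u)=\sum_{k_1\ge\cdots\ge k_u\ge 0}\frac{1}{(Nk_1+a)^{s_1}\cdots(Nk_u+a)^{s_u}},\qquad t^\star_{N,a}(\emptyset)=1 .$$ Let $\{s\}^c$ denote $s$ repeated $c$ times (the empty string if $c\le 0$). Put $\triangle(k,m)=0$ if $k=m$ and $\triangle(k,m)=1$ otherwise, and $$W^{\#}_{k,m}(s_1,\dots,s_u)=\sum_{k\ge l_1\ge\cdots\ge l_u\ge m}\frac{2^{\triangle(k,l_1)+\triangle(l_1,l_2)+\cdots+\triangle(l_u,m)}}{(Nl_1+a)^{s_1}\cdots(Nl_u+a)^{s_u}}$$ if $u\ge1$ and $k\ge m$, and $W^{\#}_{k,m}(s_1,\dots,s_u)=2^{\triangle(k,m)}$ otherwise. Let $\delta(0)=2$, $\delta(1)=1$, and $\delta(c)=0$ for $c\ge 3$.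 Let $(x)_0=1$, $(x)_n=x(x+1)\cdots(x+n-1)$ for $n\ge 1$, and let $B$ be the Beta function. Let $d,b_0,\dots,b_d\in\mathbb{N}_0$ and $c_1,\dots,c_d\in\mathbb{N}\setminus\{2\}$, with $c_1\ge 3$ if $b_0=0$ and $d\ge1$; if $d=0$ and $b_0=0$, assume also $a\ne N$. Put $k_{-1}=-1$, $c_0=1$, $c_{d+1}=0$ and $\delta_i=\delta(c_i)+\delta(c_{i+1})$ for $0\le i\le d$. Then $$t^\star_{N,a}(\{2\}^{b_0},c_1,\{2\}^{b_1},\dots,c_d,\{2\}^{b_d})=\frac{N}{B\left(\frac aN,\frac aN\right)}\sum_{k_0\ge k_1\ge\cdots\ge k_d\ge0}\frac{\left(\frac{2a}{N}\right)_{k_d}}{k_d!\,(Nk_d+a)}\prod_{i=0}^{d}\frac{(-1)^{k_i\delta_i}}{(Nk_i+a)^{2b_i+3-\delta_i}}\,W^{\#}_{k_{i-1},k_i}(\{1\}^{c_i-3}).$$ The series defining the left-hand side converges. The sum on the right-hand side is understood as the limit, as $n\to\infty$, of its finite partial sums over $n\ge k_0\ge k_1\ge\cdots\ge k_d\ge 0$,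 which exists; if $d\ge1$ or $b_0\ge1$, that sum moreover converges absolutely. -/

import Mathlib

open Filter Topology

namespace LevelTStar

noncomputable section

/-- Summand `1 / ((N k₁ + a)^{s₁} ⋯ (N k_u + a)^{s_u})` of the multiple `t`-star value of level `N`,
indexed by the weakly decreasing tuples `k₁ ≥ ⋯ ≥ k_u ≥ 0`. -/
def tStarTerm (N a : ℕ) (s : List ℕ) (k : {k : Fin s.length → ℕ // Antitone k}) : ℝ :=
  ∏ i, 1 / ((N : ℝ) * (k.1 i : ℝ) + (a : ℝ)) ^ (s.get i)

/-- The multiple `t`-star value of level `N`. For the empty index the sum has one term, equal to `1`. -/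
def tStar (N a : ℕ) (s : List ℕ) : ℝ :=
  ∑' k : {k : Fin s.length → ℕ // Antitone k}, tStarTerm N a s k

/-- The index `({2}^{b₀}, c₁, {2}^{b₁}, …, c_d, {2}^{b_d})`; `c i` stands for `c_{i+1}`. -/
def blockIndex (d : ℕ) (b : Fin (d + 1) → ℕ) (c : Fin d → ℕ) : List ℕ :=
  List.replicate (b 0) 2 ++
    (List.ofFn fun i : Fin d => c i :: List.replicate (b i.succ) 2).flatten

/-- `0` if the arguments agree and `1` otherwise. -/
def jump (k m : ℤ) : ℕ := if k = m then 0 else 1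

/-- `δ(0) = 2`, `δ(1) = 1`, and `δ(c) = 0` for `c ≥ 3` (the value at `2` is never used). -/
def delta : ℕ → ℕ
  | 0 => 2
  | 1 => 1
  | _ => 0

/-- The sequence `k, l₁, …, l_u, m`. -/
def chain {u : ℕ} (k : ℤ) (l : Fin u → ℤ) (m : ℤ) : Fin (u + 2) → ℤ :=
  Fin.cons k (Fin.snoc l m : Fin (u + 1) → ℤ)

open Classical in
/-- The finite nested sum `W^#_{k,m}(s₁, …, s_u)`; the exponent of `2` counts the jumps in the chain
`k ≥ l₁ ≥ ⋯ ≥ l_u ≥ m`. Integer arguments are allowed since `k = -1` occurs (with `u = 0`). -/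
def wSharp (N a : ℕ) {u : ℕ} (s : Fin u → ℕ) (k m : ℤ) : ℝ :=
  if u ≠ 0 ∧ m ≤ k then
    ∑ l ∈ (Fintype.piFinset fun _ : Fin u => Finset.Icc m k).filter (fun l => Antitone l),
      (2 : ℝ) ^ (∑ j : Fin (u + 1), jump (chain k l m j.castSucc) (chain k l m j.succ)) /
        ∏ i, ((N : ℝ) * (l i : ℝ) + (a : ℝ)) ^ (s i)
  else (2 : ℝ) ^ jump k m

/-- The sequence `c₀, c₁, …, c_d, c_{d+1}` with `c₀ = 1` and `c_{d+1} = 0`. -/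
def extC (d : ℕ) (c : Fin d → ℕ) : Fin (d + 2) → ℕ :=
  Fin.cons 1 (Fin.snoc c 0 : Fin (d + 1) → ℕ)

/-- The sequence `k_{-1}, k₀, …, k_d` with `k_{-1} = -1`. -/
def extK (d : ℕ) (k : Fin (d + 1) → ℕ) : Fin (d + 2) → ℤ :=
  Fin.cons (-1) (fun i => (k i : ℤ))

/-- `δ_i = δ(c_i) + δ(c_{i+1})` for `0 ≤ i ≤ d`. -/
def deltaAt (d : ℕ) (c : Fin d → ℕ) (i : Fin (d + 1)) : ℕ :=
  delta (extC d c i.castSucc) + delta (extC d c i.succ)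

/-- The summand of the nested sum over `k₀ ≥ ⋯ ≥ k_d ≥ 0`. The string `{1}^{c_i-3}` is empty
for `c_i ≤ 3`, as is `Fin (c_i - 3)` with truncated subtraction. -/
def nestedTerm (N a d : ℕ) (b : Fin (d + 1) → ℕ) (c : Fin d → ℕ) (k : Fin (d + 1) → ℕ) : ℝ :=
  (ascPochhammer ℝ (k (Fin.last d))).eval (2 * (a : ℝ) / (N : ℝ)) /
      (((k (Fin.last d)).factorial : ℝ) * ((N : ℝ) * (k (Fin.last d) : ℝ) + (a : ℝ))) *
    ∏ i : Fin (d + 1),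
      (-1 : ℝ) ^ (k i * deltaAt d c i) /
          ((N : ℝ) * (k i : ℝ) + (a : ℝ)) ^ (2 * (b i : ℤ) + 3 - (deltaAt d c i : ℤ)) *
        wSharp N a (fun _ : Fin (extC d c i.castSucc - 3) => 1)
          (extK d k i.castSucc) (extK d k i.succ)

open Classical in
/-- The partial sum of the nested sum over `n ≥ k₀ ≥ ⋯ ≥ k_d ≥ 0`. -/
def nestedPartialSum (N a d : ℕ) (b : Fin (d + 1) → ℕ) (c : Fin d → ℕ) (n : ℕ) : ℝ :=
  ∑ k ∈ (Fintype.piFinset fun _ : Fin (d + 1) => Finset.range (n + 1)).filter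
    (fun k => Antitone k), nestedTerm N a d b c k

end

end LevelTStar

namespace LevelTStar

noncomputable section

/-! Put α = a/N and let T be the transform `starSum`, (Tg)(n) = ∑_k C(n,k) g(k) with C =
`starCoeff`. The coefficients are hypergeometric in both variables, and their two ratio identities
(`starCoeff_succ_right`, `starCoeff_succ_left`) turn operations on Tg into operations on g. Summing
Tg(m)/(Nm+a)² over m ≤ n just divides g(k) by (Nk+a)² (`sum_starSum_div_sq`); multiplying or
dividing Tg(n) by Nn+a becomes a sum over l ≤ k with weights 2^△ (`lin_mul_starSum`,
`starSum_div_lin`). The constant 1 is itself the transform of an explicit alternating weight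
(`starSum_unitWeight`).

A truncated t-star sum is built from 1, innermost entry first, by the steps f ↦ ∑_{m≤n}
f(m)/(Nm+a)^c. On the side of g, c = 2 acts diagonally, c = 1 costs one jump sum, and c ≥ 3 amounts
to c-2 divisions whose composite has kernel W^#({1}^{c-3}) (`signedStep_iterate`). Hence the
truncated left side is exactly T applied to N times the fibres of the nested sum over its largest
index (`tStarFin_blockIndex`).

As n → ∞, C(n,k) tends to 1/B(α,α) for each k and stays bounded. If d ≥ 1 or b₀ ≥ 1, the fibres are
O(log^M k / k²), and dominated convergence finishes (`tendsto_starSum`). If d = b₀ = 0, absolute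
convergence may fail; but C(n,·) is decreasing, so Leibniz bounds control the tails uniformly in n
(`tendsto_starSum_sub_alternating`). -/

/-- The affine form `N k + a`. -/
def lin (N a k : ℕ) : ℝ := (N : ℝ) * (k : ℝ) + (a : ℝ)

theorem lin_pos (N : ℕ) {a : ℕ} (ha : 1 ≤ a) (k : ℕ) : 0 < lin N a k := by
  have : (0 : ℝ) < a := by exact_mod_cast ha
  unfold lin; positivity

theorem succ_le_lin {N a : ℕ} (ha : 1 ≤ a) (hN : 1 ≤ N) (k : ℕ) : (k : ℝ) + 1 ≤ lin N a k := by
  have h1 : (1 : ℝ) ≤ a := by exact_mod_cast ha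
  have h2 : (1 : ℝ) ≤ N := by exact_mod_cast hN
  have h3 : (0 : ℝ) ≤ k := k.cast_nonneg
  unfold lin; nlinarith

/-- The rising factorial `(2a/N)_k`. -/
def risingTwo (N a k : ℕ) : ℝ := (ascPochhammer ℝ k).eval (2 * (a : ℝ) / (N : ℝ))

theorem risingTwo_pos {N a : ℕ} (ha : 1 ≤ a) (hN : 1 ≤ N) (k : ℕ) : 0 < risingTwo N a k := by
  have h1 : (0 : ℝ) < a := by exact_mod_cast ha
  have h2 : (0 : ℝ) < N := by exact_mod_cast hN
  exact ascPochhammer_pos _ _ (by positivity)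

theorem risingTwo_succ {N : ℕ} (a : ℕ) (hN : 1 ≤ N) (k : ℕ) :
    (N : ℝ) * risingTwo N a (k + 1) = risingTwo N a k * (2 * a + N * k) := by
  have h2 : (N : ℝ) ≠ 0 := by exact_mod_cast (by omega : N ≠ 0)
  unfold risingTwo
  rw [ascPochhammer_succ_eval]
  field_simp

/-! ### Transform coefficients: recursions, monotonicity, limit -/

/-- The coefficients of the finite identities: `(α)_{n+1}² / ((n-k)! (2α)_{n+k+1})` with
`α = a / N` for `k ≤ n`, and `0` for `k > n`. -/
def starCoeff (N a n k : ℕ) : ℝ :=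
  if k ≤ n then
    (ascPochhammer ℝ (n + 1)).eval ((a : ℝ) / N) ^ 2 /
      (((n - k).factorial : ℝ) * risingTwo N a (n + k + 1))
  else 0

theorem starCoeff_of_lt {N a n k : ℕ} (h : n < k) : starCoeff N a n k = 0 := by
  simp [starCoeff, Nat.not_le.2 h]

theorem starCoeff_nonneg {N a : ℕ} (ha : 1 ≤ a) (hN : 1 ≤ N) (n k : ℕ) :
    0 ≤ starCoeff N a n k := by
  unfold starCoeff
  have := risingTwo_pos ha hN (n + k + 1)
  split_ifs <;> positivity

/-- The ratio of neighbouring coefficients, cleared of denominators so that it stays valid for k ≥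
n, where both sides vanish. -/
theorem starCoeff_succ_right {N a : ℕ} (ha : 1 ≤ a) (hN : 1 ≤ N) (n k : ℕ) :
    (N : ℝ) * ((n : ℝ) - k) * starCoeff N a n k =
      (2 * a + N * ((n : ℝ) + k + 1)) * starCoeff N a n (k + 1) := by
  rcases lt_trichotomy n k with h | rfl | h
  · rw [starCoeff_of_lt h, starCoeff_of_lt (by omega)]; ring
  · rw [starCoeff_of_lt (Nat.lt_succ_self n)]; ring
  · obtain ⟨j, rfl⟩ : ∃ j, n = k + 1 + j := ⟨n - (k + 1), by omega⟩
    have hN' : (0 : ℝ) < N := by exact_mod_cast hN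
    have ha' : (0 : ℝ) < a := by exact_mod_cast ha
    have e1 : k + 1 + j - k = j + 1 := by omega
    have e2 : k + 1 + j - (k + 1) = j := by omega
    have p1 := risingTwo_pos ha hN (k + 1 + j + k + 1)
    have p2 := risingTwo_pos ha hN (k + 1 + j + k + 1 + 1)
    have s := risingTwo_succ a hN (k + 1 + j + k + 1)
    have hs : risingTwo N a (k + 1 + j + k + 1 + 1)
        = risingTwo N a (k + 1 + j + k + 1) * (2 * a + N * ((k + 1 + j + k + 1 : ℕ) : ℝ)) / N := by
      field_simp; linarith
    unfold starCoeff
    rw [if_pos (by omega), if_pos (by omega), e1, e2, Nat.factorial_succ,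
      show k + 1 + j + (k + 1) + 1 = k + 1 + j + k + 1 + 1 by omega, hs]
    have hf : (0 : ℝ) < (j.factorial : ℝ) := by exact_mod_cast j.factorial_pos
    push_cast
    have : (0 : ℝ) < 2 * a + N * ((k : ℝ) + 1 + j + k + 1) := by positivity
    field_simp
    ring

/-- The difference of squares factors as N(n+1-k)·(2a+N(n+1+k)), the two factors by which the
factorial and the rising factorial grow from n to n+1. -/
theorem starCoeff_succ_left {N a : ℕ} (ha : 1 ≤ a) (hN : 1 ≤ N) {n k : ℕ} (hk : k ≤ n + 1) :
    lin N a (n + 1) ^ 2 * starCoeff N a n k =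
      (lin N a (n + 1) ^ 2 - lin N a k ^ 2) * starCoeff N a (n + 1) k := by
  rcases hk.eq_or_lt with rfl | h
  · rw [starCoeff_of_lt (Nat.lt_succ_self n)]; ring
  · obtain ⟨j, rfl⟩ : ∃ j, n = k + j := ⟨n - k, by omega⟩
    have hN' : (0 : ℝ) < N := by exact_mod_cast hN
    have ha' : (0 : ℝ) < a := by exact_mod_cast ha
    have e1 : k + j + 1 - k = j + 1 := by omega
    have e2 : k + j - k = j := by omega
    have p1 := risingTwo_pos ha hN (k + j + k + 1)
    have s := risingTwo_succ a hN (k + j + k + 1)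
    have hs : risingTwo N a (k + j + k + 1 + 1)
        = risingTwo N a (k + j + k + 1) * (2 * a + N * ((k + j + k + 1 : ℕ) : ℝ)) / N := by
      field_simp; linarith
    unfold starCoeff lin
    rw [if_pos (by omega), if_pos (by omega), e1, e2, Nat.factorial_succ,
      show k + j + 1 + k + 1 = k + j + k + 1 + 1 by omega, hs, ascPochhammer_succ_eval (k + j + 1)]
    have hf : (0 : ℝ) < (j.factorial : ℝ) := by exact_mod_cast j.factorial_pos
    push_cast
    have : (0 : ℝ) < 2 * a + N * ((k : ℝ) + j + k + 1) := by positivity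
    field_simp
    ring

theorem starCoeff_antitone {N a : ℕ} (ha : 1 ≤ a) (hN : 1 ≤ N) (n : ℕ) :
    Antitone (starCoeff N a n) := by
  refine antitone_nat_of_succ_le fun k => ?_
  rcases lt_or_ge n k with h | h
  · rw [starCoeff_of_lt h, starCoeff_of_lt (by omega)]
  · have hN' : (0 : ℝ) < N := by exact_mod_cast hN
    have ha' : (0 : ℝ) < a := by exact_mod_cast ha
    have h' : (k : ℝ) ≤ n := by exact_mod_cast h
    have h0 := starCoeff_nonneg ha hN n (k + 1)
    have h1 := starCoeff_nonneg ha hN n k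
    have key := starCoeff_succ_right ha hN n k
    have hk : (0 : ℝ) ≤ k := k.cast_nonneg
    have hp : (0 : ℝ) < 2 * a + N * ((n : ℝ) + k + 1) := by positivity
    refine le_of_mul_le_mul_left ?_ hp
    rw [← key]
    refine mul_le_mul_of_nonneg_right ?_ h1
    nlinarith

theorem prod_range_add_natCast (s : ℝ) (m : ℕ) :
    ∏ j ∈ Finset.range m, (s + j) = (ascPochhammer ℝ m).eval s := by
  induction m with
  | zero => simp
  | succ m ih => rw [Finset.prod_range_succ, ih, ascPochhammer_succ_eval]

/-- The powers of n cancel in Euler's products. At n = 0 the real power is 0 and the quotient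
degenerates. -/
theorem starCoeff_zero_eq {N a : ℕ} (ha : 1 ≤ a) (hN : 1 ≤ N) {n : ℕ} (hn : n ≠ 0) :
    starCoeff N a n 0 = Real.GammaSeq (2 * a / N) n / Real.GammaSeq (a / N) n ^ 2 := by
  have hN' : (0 : ℝ) < N := by exact_mod_cast hN
  have ha' : (0 : ℝ) < a := by exact_mod_cast ha
  have hn' : (0 : ℝ) < n := by exact_mod_cast Nat.pos_of_ne_zero hn
  have p1 := risingTwo_pos ha hN (n + 1)
  have p2 : 0 < (ascPochhammer ℝ (n + 1)).eval ((a : ℝ) / N) :=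
    ascPochhammer_pos _ _ (by positivity)
  have hf : (0 : ℝ) < (n.factorial : ℝ) := by exact_mod_cast n.factorial_pos
  have hpow : (n : ℝ) ^ (2 * (a : ℝ) / N) = ((n : ℝ) ^ ((a : ℝ) / N)) ^ 2 := by
    rw [← Real.rpow_natCast, ← Real.rpow_mul hn'.le]; congr 1; push_cast; ring
  have hq : 0 < (n : ℝ) ^ ((a : ℝ) / N) := Real.rpow_pos_of_pos hn' _
  unfold starCoeff Real.GammaSeq
  rw [if_pos (Nat.zero_le _), prod_range_add_natCast, prod_range_add_natCast, hpow]
  change _ = _ / risingTwo N a (n + 1) / _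
  simp only [Nat.sub_zero, Nat.add_zero]
  field_simp

theorem tendsto_starCoeff_zero {N a : ℕ} (ha : 1 ≤ a) (hN : 1 ≤ N) :
    Tendsto (fun n => starCoeff N a n 0) atTop
      (𝓝 (1 / ProbabilityTheory.beta ((a : ℝ) / N) ((a : ℝ) / N))) := by
  have hN' : (0 : ℝ) < N := by exact_mod_cast hN
  have ha' : (0 : ℝ) < a := by exact_mod_cast ha
  have hG : 0 < Real.Gamma ((a : ℝ) / N) := Real.Gamma_pos_of_pos (by positivity)
  have := (Real.GammaSeq_tendsto_Gamma (2 * a / N)).div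
    ((Real.GammaSeq_tendsto_Gamma (a / N)).pow 2) (by positivity)
  have h2 : (1 : ℝ) / ProbabilityTheory.beta ((a : ℝ) / N) ((a : ℝ) / N)
      = Real.Gamma (2 * a / N) / Real.Gamma (a / N) ^ 2 := by
    unfold ProbabilityTheory.beta
    rw [one_div_div, ← two_mul, mul_div_assoc, sq]
  rw [h2]
  refine this.congr' ?_
  filter_upwards [eventually_ne_atTop 0] with n hn using (starCoeff_zero_eq ha hN hn).symm

/-- For fixed k the ratio of neighbouring coefficients tends to 1, so the limit does not depend on
k. -/
theorem tendsto_starCoeff {N a : ℕ} (ha : 1 ≤ a) (hN : 1 ≤ N) (k : ℕ) :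
    Tendsto (fun n => starCoeff N a n k) atTop
      (𝓝 (1 / ProbabilityTheory.beta ((a : ℝ) / N) ((a : ℝ) / N))) := by
  have hN' : (0 : ℝ) < N := by exact_mod_cast hN
  have ha' : (0 : ℝ) < a := by exact_mod_cast ha
  induction k with
  | zero => exact tendsto_starCoeff_zero ha hN
  | succ k ih =>
    have hr : Tendsto (fun n : ℕ => ((n : ℝ) + (-k)) / (n + (2 * a / N + k + 1))) atTop (𝓝 1) := by
      have h1 : Tendsto (fun n : ℕ => (2 * (a : ℝ) / N + k + 1) + n) atTop atTop :=
        tendsto_atTop_add_const_left _ _ tendsto_natCast_atTop_atTop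
      have h2 : Tendsto (fun n : ℕ => 1 - (2 * (a : ℝ) / N + k + 1 + k) /
          ((2 * (a : ℝ) / N + k + 1) + n)) atTop (𝓝 (1 - 0)) :=
        tendsto_const_nhds.sub (h1.const_div_atTop _)
      rw [sub_zero] at h2
      refine h2.congr fun n => ?_
      have : (0 : ℝ) < n + (2 * a / N + k + 1) := by positivity
      have : (0 : ℝ) < (2 * (a : ℝ) / N + k + 1) + n := by positivity
      field_simp
      ring
    have := hr.mul ih
    rw [one_mul] at this
    refine this.congr fun n => ?_
    have key := starCoeff_succ_right ha hN n k
    have hp : (0 : ℝ) < n + (2 * a / N + k + 1) := by positivity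
    have e : (2 * a + N * ((n : ℝ) + k + 1)) = N * (n + (2 * a / N + k + 1)) := by
      field_simp; ring
    rw [e] at key
    rw [div_mul_eq_mul_div, div_eq_iff hp.ne']
    have := mul_left_cancel₀ hN'.ne' (show (N : ℝ) * (((n : ℝ) - k) * starCoeff N a n k)
      = N * ((n + (2 * a / N + k + 1)) * starCoeff N a n (k + 1)) by linarith)
    linarith

theorem starCoeff_le {N a : ℕ} (ha : 1 ≤ a) (hN : 1 ≤ N) :
    ∃ K : ℝ, ∀ n k, starCoeff N a n k ≤ K := by
  obtain ⟨K, hK⟩ := (tendsto_starCoeff_zero ha hN).bddAbove_range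
  exact ⟨K, fun n k => (starCoeff_antitone ha hN n (Nat.zero_le k)).trans (hK ⟨n, rfl⟩)⟩

/-! ### The transform and its operational rules -/

/-- The transform `n ↦ ∑_{k ≤ n} C(n, k) g(k)` with the coefficients `starCoeff`. -/
def starSum (N a : ℕ) (g : ℕ → ℝ) (n : ℕ) : ℝ :=
  ∑ k ∈ Finset.range (n + 1), starCoeff N a n k * g k

/-- The sum `∑_{l ≤ k} 2^{△(k, l)} g(l)`. -/
def jumpSum (g : ℕ → ℝ) (k : ℕ) : ℝ :=
  ∑ l ∈ Finset.range (k + 1), (2 : ℝ) ^ jump k l * g l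

theorem sum_range_range_comm (n : ℕ) (f : ℕ → ℕ → ℝ) :
    ∑ k ∈ Finset.range (n + 1), ∑ l ∈ Finset.range (k + 1), f k l =
      ∑ l ∈ Finset.range (n + 1), ∑ k ∈ Finset.Ico l (n + 1), f k l := by
  refine Finset.sum_comm' fun k l => ?_
  simp only [Finset.mem_range, Finset.mem_Ico]
  omega

theorem starSum_jumpSum (N a : ℕ) (w g : ℕ → ℝ) (n : ℕ) :
    starSum N a (fun k => w k * jumpSum g k) n =
      ∑ l ∈ Finset.range (n + 1),
        (∑ k ∈ Finset.Ico l (n + 1), starCoeff N a n k * w k * 2 ^ jump k l) * g l := by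
  unfold starSum jumpSum
  simp_rw [Finset.mul_sum, Finset.sum_mul]
  rw [sum_range_range_comm]
  refine Finset.sum_congr rfl fun l _ => Finset.sum_congr rfl fun k _ => ?_
  ring

theorem sum_Ico_jump {l n : ℕ} (h : l ≤ n) (f : ℕ → ℝ) :
    ∑ k ∈ Finset.Ico l (n + 1), f k * 2 ^ jump k l =
      f l + ∑ k ∈ Finset.Ico l n, 2 * f (k + 1) := by
  rw [Finset.sum_eq_sum_Ico_succ_bot (by omega), Finset.sum_Ico_add' (fun k => 2 * f k)]
  congr 1
  · simp [jump]
  · refine Finset.sum_congr rfl fun k hk => ?_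
    rw [Finset.mem_Ico] at hk
    have : (k : ℤ) ≠ l := by omega
    simp [jump, this, mul_comm]

/-- Telescoping of N(n-k)C(n,k): its decrement from k to k+1 is 2(N(k+1)+a)C(n,k+1), since
(2a+N(n+k+1)) - N(n-k-1) = 2(N(k+1)+a). -/
theorem sum_starCoeff_lin_jump {N a : ℕ} (ha : 1 ≤ a) (hN : 1 ≤ N) {l n : ℕ} (h : l ≤ n) :
    ∑ k ∈ Finset.Ico l (n + 1), starCoeff N a n k * lin N a k * 2 ^ jump k l =
      lin N a n * starCoeff N a n l := by
  rw [sum_Ico_jump h fun k => starCoeff N a n k * lin N a k]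
  have : ∀ k : ℕ, 2 * (starCoeff N a n (k + 1) * lin N a (k + 1)) =
      -((N : ℝ) * ((n : ℝ) - (k + 1 : ℕ)) * starCoeff N a n (k + 1))
        - -((N : ℝ) * ((n : ℝ) - k) * starCoeff N a n k) := by
    intro k
    have key := starCoeff_succ_right ha hN n k
    unfold lin
    push_cast
    linear_combination -key
  simp_rw [this]
  rw [Finset.sum_Ico_sub (fun k : ℕ => -((N : ℝ) * ((n : ℝ) - k) * starCoeff N a n k)) h]
  unfold lin
  ring

/-- The same telescoping with signs: the two linear factors are now added, giving 2(Nn+a), which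
does not involve k and can be divided out. -/
theorem sum_starCoeff_sign_jump {N a : ℕ} (ha : 1 ≤ a) (hN : 1 ≤ N) {l n : ℕ} (h : l ≤ n) :
    ∑ k ∈ Finset.Ico l (n + 1), starCoeff N a n k * (-1) ^ k * 2 ^ jump k l =
      (-1) ^ l * starCoeff N a n l * (lin N a l / lin N a n) := by
  have hx := lin_pos N ha n
  rw [sum_Ico_jump h fun k => starCoeff N a n k * (-1) ^ k]
  have : ∀ k : ℕ, 2 * (starCoeff N a n (k + 1) * (-1) ^ (k + 1)) =
      (-1) ^ (k + 1) * ((N : ℝ) * ((n : ℝ) - (k + 1 : ℕ)) * starCoeff N a n (k + 1)) / lin N a n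
        - (-1) ^ k * ((N : ℝ) * ((n : ℝ) - k) * starCoeff N a n k) / lin N a n := by
    intro k
    have key := starCoeff_succ_right ha hN n k
    rw [← sub_div, eq_div_iff hx.ne']
    unfold lin
    push_cast
    rw [pow_succ]
    linear_combination (-1) ^ k * key
  simp_rw [this]
  rw [Finset.sum_Ico_sub
    (fun k : ℕ => (-1) ^ k * ((N : ℝ) * ((n : ℝ) - k) * starCoeff N a n k) / lin N a n) h]
  field_simp
  unfold lin
  ring

theorem lin_mul_starSum {N a : ℕ} (ha : 1 ≤ a) (hN : 1 ≤ N) (g : ℕ → ℝ) (n : ℕ) :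
    lin N a n * starSum N a g n = starSum N a (fun k => lin N a k * jumpSum g k) n := by
  rw [starSum_jumpSum, starSum, Finset.mul_sum]
  refine Finset.sum_congr rfl fun l hl => ?_
  rw [sum_starCoeff_lin_jump ha hN (by simpa [Nat.lt_succ_iff] using hl)]
  ring

/-- Division by the affine form corresponds to this operator under `starSum`. -/
def signedStep (N a : ℕ) (g : ℕ → ℝ) (k : ℕ) : ℝ :=
  (-1) ^ k * jumpSum (fun l => (-1) ^ l / lin N a l * g l) k

theorem starSum_div_lin {N a : ℕ} (ha : 1 ≤ a) (hN : 1 ≤ N) (g : ℕ → ℝ) (n : ℕ) :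
    starSum N a g n / lin N a n = starSum N a (signedStep N a g) n := by
  unfold signedStep
  rw [starSum_jumpSum, starSum, Finset.sum_div]
  refine Finset.sum_congr rfl fun l hl => ?_
  rw [sum_starCoeff_sign_jump ha hN (by simpa [Nat.lt_succ_iff] using hl)]
  have h1 := lin_pos N ha n
  have h2 := lin_pos N ha l
  have h3 : ((-1 : ℝ) ^ l) * (-1) ^ l = 1 := by rw [← mul_pow]; simp
  field_simp
  linear_combination (-starCoeff N a n l * g l) * h3

theorem starSum_div_lin_pow {N a : ℕ} (ha : 1 ≤ a) (hN : 1 ≤ N) (g : ℕ → ℝ) (n u : ℕ) :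
    starSum N a g n / lin N a n ^ u = starSum N a ((signedStep N a)^[u] g) n := by
  induction u generalizing g with
  | zero => simp
  | succ u ih =>
    rw [Function.iterate_succ_apply, ← ih, ← starSum_div_lin ha hN, pow_succ', div_div]

/-- Induction on n, where `starCoeff_succ_left` matches the increment term by term. This is why
entries equal to 2 act diagonally. -/
theorem sum_starSum_div_sq {N a : ℕ} (ha : 1 ≤ a) (hN : 1 ≤ N) (g : ℕ → ℝ) (n : ℕ) :
    ∑ m ∈ Finset.range (n + 1), starSum N a g m / lin N a m ^ 2 =
      starSum N a (fun k => g k / lin N a k ^ 2) n := by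
  induction n with
  | zero => simp [starSum, mul_div_assoc]
  | succ n ih =>
    rw [Finset.sum_range_succ, ih]
    have hx := lin_pos N ha (n + 1)
    -- Padding by the vanishing term k = n+1 brings both levels to the same range.
    have e : starSum N a (fun k => g k / lin N a k ^ 2) n =
        ∑ k ∈ Finset.range (n + 1 + 1), starCoeff N a n k * (g k / lin N a k ^ 2) := by
      rw [Finset.sum_range_succ _ (n + 1), starCoeff_of_lt (Nat.lt_succ_self n)]
      simp [starSum]
    rw [e, starSum, starSum, Finset.sum_div, ← Finset.sum_add_distrib]
    refine Finset.sum_congr rfl fun k hk => ?_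
    have hk' := lin_pos N ha k
    have key := starCoeff_succ_left ha hN (show k ≤ n + 1 by
      simpa [Nat.lt_succ_iff] using hk)
    field_simp
    linear_combination (g k) * key

theorem sum_starSum_div {N a : ℕ} (ha : 1 ≤ a) (hN : 1 ≤ N) (g : ℕ → ℝ) (n : ℕ) :
    ∑ m ∈ Finset.range (n + 1), starSum N a g m / lin N a m =
      starSum N a (fun k => jumpSum g k / lin N a k) n := by
  have e : ∀ m, starSum N a g m / lin N a m =
      starSum N a (fun k => lin N a k * jumpSum g k) m / lin N a m ^ 2 := by
    intro m
    have := lin_pos N ha m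
    rw [← lin_mul_starSum ha hN]
    field_simp
  simp_rw [e]
  rw [sum_starSum_div_sq ha hN]
  congr 1
  funext k
  have := lin_pos N ha k
  field_simp

theorem sum_starSum_div_pow {N a : ℕ} (ha : 1 ≤ a) (hN : 1 ≤ N) (g : ℕ → ℝ) (n u : ℕ) :
    ∑ m ∈ Finset.range (n + 1), starSum N a g m / lin N a m ^ (u + 2) =
      starSum N a (fun k => (signedStep N a)^[u] g k / lin N a k ^ 2) n := by
  rw [← sum_starSum_div_sq ha hN]
  refine Finset.sum_congr rfl fun m _ => ?_
  rw [pow_add, ← div_div, starSum_div_lin_pow ha hN]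

/-! ### The preimage of the constant 1 -/

/-- The function whose transform under `starSum` is constantly `1`. -/
def unitWeight (N a k : ℕ) : ℝ :=
  2 * N * ((-1) ^ k * (risingTwo N a k / (k.factorial * lin N a k)))

/-- A closed form for partial sums of a Gosper-summable term. Its right side contains C(n+1,k), so
the complete sum, k = n+2, vanishes. -/
theorem starSum_unitWeight_aux {N a : ℕ} (ha : 1 ≤ a) (hN : 1 ≤ N) (n k : ℕ) :
    2 * ((n : ℝ) + 1) * ∑ j ∈ Finset.range k,
      starCoeff N a (n + 1) j * ((-1) ^ j * lin N a j * (risingTwo N a j / j.factorial)) =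
    (-1) ^ (k + 1) * starCoeff N a (n + 1) k * (risingTwo N a k / k.factorial) * k *
      (2 * a + N * ((n : ℝ) + 1 + k)) := by
  have hN' : (0 : ℝ) < N := by exact_mod_cast hN
  induction k with
  | zero => simp
  | succ k ih =>
    rw [Finset.sum_range_succ, mul_add, ih]
    have key := starCoeff_succ_right ha hN (n + 1) k
    have s := risingTwo_succ a hN k
    have hs : risingTwo N a (k + 1) / (k + 1).factorial * (k + 1 : ℕ) =
        risingTwo N a k / k.factorial * (2 * a + N * k) / N := by
      have hf : (0 : ℝ) < (k.factorial : ℝ) := by exact_mod_cast k.factorial_pos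
      have hf' : (0 : ℝ) < (k + 1).factorial := by exact_mod_cast (k + 1).factorial_pos
      have e : ((k + 1).factorial : ℝ) = (k + 1) * k.factorial := by
        push_cast [Nat.factorial_succ]; ring
      rw [e]
      push_cast
      field_simp
      linear_combination s
    have hr : (-1 : ℝ) ^ (k + 1 + 1) * starCoeff N a (n + 1) (k + 1) *
        (risingTwo N a (k + 1) / (k + 1).factorial) * (k + 1 : ℕ) *
          (2 * a + N * ((n : ℝ) + 1 + (k + 1 : ℕ))) =
        (-1) ^ k * (risingTwo N a k / k.factorial * (2 * a + N * k)) *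
          (((n : ℝ) + 1 - k) * starCoeff N a (n + 1) k) := by
      have k2 : (2 * a + N * ((n : ℝ) + 1 + (k + 1 : ℕ))) * starCoeff N a (n + 1) (k + 1) / N =
          ((n : ℝ) + 1 - k) * starCoeff N a (n + 1) k := by
        rw [div_eq_iff hN'.ne']
        push_cast at key ⊢
        linear_combination -key
      rw [← k2]
      linear_combination ((-1) ^ k * starCoeff N a (n + 1) (k + 1) *
        (2 * a + N * ((n : ℝ) + 1 + (k + 1 : ℕ)))) * hs
    rw [hr]
    unfold lin
    ring

theorem starSum_unitWeight {N a : ℕ} (ha : 1 ≤ a) (hN : 1 ≤ N) (n : ℕ) :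
    starSum N a (unitWeight N a) n = 1 := by
  have hN' : (0 : ℝ) < N := by exact_mod_cast hN
  have ha' : (0 : ℝ) < a := by exact_mod_cast ha
  induction n with
  | zero =>
    have : risingTwo N a 1 = 2 * a / N := by simp [risingTwo]
    have h0 : risingTwo N a 0 = 1 := by simp [risingTwo]
    simp [starSum, unitWeight, starCoeff, lin, this, h0]
    field_simp
  | succ n ih =>
    have h := sum_starSum_div_sq ha hN (fun k => unitWeight N a k * lin N a k ^ 2) (n + 1)
    rw [Finset.sum_range_succ, sum_starSum_div_sq ha hN] at h
    have e : (fun k => unitWeight N a k * lin N a k ^ 2 / lin N a k ^ 2) = unitWeight N a := by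
      funext k
      have := lin_pos N ha k
      field_simp
    -- By `sum_starSum_div_sq`, this transform over (N(n+1)+a)² is the increment of the transform of
    -- `unitWeight` from n to n+1.
    have hz : starSum N a (fun k => unitWeight N a k * lin N a k ^ 2) (n + 1) = 0 := by
      have aux := starSum_unitWeight_aux ha hN n (n + 1 + 1)
      rw [starCoeff_of_lt (Nat.lt_succ_self (n + 1))] at aux
      have hn : (2 * ((n : ℝ) + 1)) ≠ 0 := by positivity
      have aux' : ∑ j ∈ Finset.range (n + 1 + 1), starCoeff N a (n + 1) j *
          ((-1) ^ j * lin N a j * (risingTwo N a j / j.factorial)) = 0 := by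
        refine (mul_eq_zero.1 (aux.trans ?_)).resolve_left hn
        ring
      have : starSum N a (fun k => unitWeight N a k * lin N a k ^ 2) (n + 1) =
          2 * N * ∑ j ∈ Finset.range (n + 1 + 1), starCoeff N a (n + 1) j *
          ((-1) ^ j * lin N a j * (risingTwo N a j / j.factorial)) := by
        rw [starSum, Finset.mul_sum]
        refine Finset.sum_congr rfl fun j _ => ?_
        have := lin_pos N ha j
        have hf : (0 : ℝ) < (j.factorial : ℝ) := by exact_mod_cast j.factorial_pos
        unfold unitWeight
        field_simp
      rw [this, aux', mul_zero]
    rw [e, ih, hz, zero_div, add_zero] at h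
    exact h.symm

/-! ### Decreasing tuples and the recursion for W^# -/

theorem antitone_cons_iff {α : Type*} [Preorder α] {u : ℕ} (x : α) (f : Fin u → α) :
    Antitone (Fin.cons x f : Fin (u + 1) → α) ↔ (∀ i, f i ≤ x) ∧ Antitone f := by
  refine ⟨fun h => ⟨fun i => by simpa using h (Fin.zero_le i.succ), fun i j hij => by
    simpa using h (Fin.succ_le_succ_iff.2 hij)⟩, fun ⟨h1, h2⟩ i j hij => ?_⟩
  cases i using Fin.cases with
  | zero =>
    cases j using Fin.cases with
    | zero => exact le_rfl
    | succ j => simpa using h1 j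
  | succ i =>
    cases j using Fin.cases with
    | zero => exact absurd hij (by simp)
    | succ j => simpa using h2 (Fin.succ_le_succ_iff.1 hij)

open Classical in
/-- The weakly decreasing tuples with entries in `[m, n]`. -/
def antitoneBox {α : Type*} [LinearOrder α] [LocallyFiniteOrder α] (u : ℕ) (m n : α) :
    Finset (Fin u → α) :=
  (Fintype.piFinset fun _ : Fin u => Finset.Icc m n).filter (fun l => Antitone l)

theorem mem_antitoneBox {α : Type*} [LinearOrder α] [LocallyFiniteOrder α] {u : ℕ} {m n : α}
    {f : Fin u → α} : f ∈ antitoneBox u m n ↔ (∀ i, m ≤ f i ∧ f i ≤ n) ∧ Antitone f := by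
  simp [antitoneBox]

theorem sum_antitoneBox_zero {α : Type*} [LinearOrder α] [LocallyFiniteOrder α] (m n : α)
    (F : (Fin 0 → α) → ℝ) : ∑ f ∈ antitoneBox 0 m n, F f = F Fin.elim0 := by
  have : antitoneBox 0 m n = {Fin.elim0} := by
    ext f
    rw [mem_antitoneBox, Finset.mem_singleton]
    exact ⟨fun _ => Subsingleton.elim _ _, fun _ => ⟨fun i => i.elim0, fun i => i.elim0⟩⟩
  rw [this, Finset.sum_singleton]

/-- The first coordinate is the largest, so it becomes the upper bound for the rest. The order is
kept general to serve both ℕ (summation indices) and ℤ (W^#). -/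
theorem sum_antitoneBox_succ {α : Type*} [LinearOrder α] [LocallyFiniteOrder α] (u : ℕ) (m n : α)
    (F : (Fin (u + 1) → α) → ℝ) :
    ∑ f ∈ antitoneBox (u + 1) m n, F f =
      ∑ x ∈ Finset.Icc m n, ∑ f ∈ antitoneBox u m x, F (Fin.cons x f) := by
  rw [Finset.sum_sigma']
  refine Finset.sum_bij' (fun f _ => ⟨f 0, Fin.tail f⟩)
    (fun p _ => (Fin.cons p.1 p.2 : Fin (u + 1) → α)) ?_ ?_ ?_ ?_ ?_
  · intro f hf
    rw [mem_antitoneBox] at hf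
    have h := hf.2
    rw [← Fin.cons_self_tail f, antitone_cons_iff] at h
    simp only [Finset.mem_sigma, Finset.mem_Icc, mem_antitoneBox]
    exact ⟨hf.1 0, fun i => ⟨(hf.1 i.succ).1, h.1 i⟩, h.2⟩
  · rintro ⟨x, f⟩ h
    simp only [Finset.mem_sigma, Finset.mem_Icc, mem_antitoneBox] at h
    rw [mem_antitoneBox, antitone_cons_iff]
    refine ⟨fun i => ?_, fun i => (h.2.1 i).2, h.2.2⟩
    cases i using Fin.cases with
    | zero => simpa using h.1
    | succ i => simpa using ⟨(h.2.1 i).1, (h.2.1 i).2.trans h.1.2⟩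
  · intro f _
    exact Fin.cons_self_tail f
  · rintro ⟨x, f⟩ _
    simp
  · intro f _
    rw [Fin.cons_self_tail]

/-- The sum `W^#_{k,m}({1}^u)`. -/
def wOnes (N a u : ℕ) (k m : ℤ) : ℝ := wSharp N a (fun _ : Fin u => 1) k m

theorem wOnes_zero (N a : ℕ) (k m : ℤ) : wOnes N a 0 k m = 2 ^ jump k m := by
  simp [wOnes, wSharp]

/-- The summand of `W^#_{k,m}({1}^u)`. -/
def wOnesTerm (N a : ℕ) {u : ℕ} (k m : ℤ) (l : Fin u → ℤ) : ℝ :=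
  (2 : ℝ) ^ (∑ j : Fin (u + 1), jump (chain k l m j.castSucc) (chain k l m j.succ)) /
    ∏ i, ((N : ℝ) * (l i : ℝ) + (a : ℝ)) ^ 1

/-- The separate branch at u = 0 agrees with the sum over the single empty tuple, so the recursion
can start there. -/
theorem wOnes_eq_sum (N a u : ℕ) {k m : ℤ} (h : m ≤ k) :
    wOnes N a u k m = ∑ l ∈ antitoneBox u m k, wOnesTerm N a k m l := by
  rcases Nat.eq_zero_or_pos u with rfl | hu
  · rw [wOnes_zero, sum_antitoneBox_zero]
    simp [wOnesTerm, chain, Fin.snoc]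
  · unfold wOnes wSharp
    rw [if_pos ⟨hu.ne', h⟩]
    rfl

theorem wOnesTerm_cons (N a : ℕ) {u : ℕ} (k m x : ℤ) (l : Fin u → ℤ) :
    wOnesTerm N a k m (Fin.cons x l : Fin (u + 1) → ℤ) =
      2 ^ jump k x / (N * (x : ℝ) + a) * wOnesTerm N a x m l := by
  have hc : chain k (Fin.cons x l : Fin (u + 1) → ℤ) m = Fin.cons k (chain x l m) := by
    unfold chain
    rw [← Fin.cons_snoc_eq_snoc_cons]
  unfold wOnesTerm
  rw [hc, Fin.sum_univ_succ, Fin.prod_univ_succ, pow_add]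
  simp only [Fin.castSucc_zero, Fin.cons_zero, Fin.cons_succ, ← Fin.succ_castSucc, pow_one]
  have : chain x l m 0 = x := rfl
  rw [this, div_mul_div_comm]

theorem wOnes_succ (N a u : ℕ) {k m : ℤ} (h : m ≤ k) :
    wOnes N a (u + 1) k m =
      ∑ x ∈ Finset.Icc m k, 2 ^ jump k x / (N * (x : ℝ) + a) * wOnes N a u x m := by
  rw [wOnes_eq_sum _ _ _ h, sum_antitoneBox_succ]
  refine Finset.sum_congr rfl fun x hx => ?_
  rw [wOnes_eq_sum _ _ _ (Finset.mem_Icc.1 hx).1, Finset.mul_sum]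
  exact Finset.sum_congr rfl fun l _ => wOnesTerm_cons N a k m x l

theorem wOnes_succ_nat (N a u : ℕ) {k m : ℕ} (h : m ≤ k) :
    wOnes N a (u + 1) k m =
      ∑ x ∈ Finset.Ico m (k + 1), 2 ^ jump k x / lin N a x * wOnes N a u x m := by
  rw [wOnes_succ N a u (by exact_mod_cast h)]
  symm
  refine Finset.sum_bij' (fun x _ => (x : ℤ)) (fun x _ => x.toNat) ?_ ?_ ?_ ?_ ?_
  · intro x hx
    rw [Finset.mem_Ico] at hx
    rw [Finset.mem_Icc]
    omega
  · intro x hx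
    rw [Finset.mem_Icc] at hx
    rw [Finset.mem_Ico]
    omega
  · intro x _
    exact Int.toNat_natCast x
  · intro x hx
    rw [Finset.mem_Icc] at hx
    exact Int.toNat_of_nonneg (by omega)
  · intro x _
    simp [lin]

theorem wOnes_nonneg (N : ℕ) {a : ℕ} (ha : 1 ≤ a) (u : ℕ) {k m : ℕ} (h : m ≤ k) :
    0 ≤ wOnes N a u k m := by
  induction u generalizing k with
  | zero => rw [wOnes_zero]; positivity
  | succ u ih =>
    rw [wOnes_succ_nat N a u h]
    refine Finset.sum_nonneg fun x hx => ?_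
    have := ih (Finset.mem_Ico.1 hx).1
    have := lin_pos N ha x
    positivity

/-- The signs of consecutive steps cancel at each intermediate index, leaving the nested jump sum
that defines W^#; only the outermost and innermost signs survive. -/
theorem signedStep_iterate (N a u : ℕ) (g : ℕ → ℝ) (k : ℕ) :
    (signedStep N a)^[u + 1] g k =
      (-1) ^ k * ∑ m ∈ Finset.range (k + 1),
        wOnes N a u k m * ((-1) ^ m / lin N a m * g m) := by
  induction u generalizing k with
  | zero => simp [signedStep, jumpSum, wOnes_zero]
  | succ u ih =>
    rw [Function.iterate_succ_apply']
    unfold signedStep jumpSum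
    congr 1
    have : ∀ l : ℕ, (2 : ℝ) ^ jump k l * ((-1) ^ l / lin N a l * (signedStep N a)^[u + 1] g l) =
        ∑ m ∈ Finset.range (l + 1), 2 ^ jump k l / lin N a l * wOnes N a u l m *
          ((-1) ^ m / lin N a m * g m) := by
      intro l
      rw [ih, Finset.mul_sum, Finset.mul_sum, Finset.mul_sum]
      refine Finset.sum_congr rfl fun m _ => ?_
      have h3 : ((-1 : ℝ) ^ l) * (-1) ^ l = 1 := by rw [← mul_pow]; simp
      linear_combination (2 ^ jump k l / lin N a l * wOnes N a u l m *
          ((-1) ^ m / lin N a m * g m)) * h3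
    change ∑ l ∈ Finset.range (k + 1), (2 : ℝ) ^ jump k l *
      ((-1) ^ l / lin N a l * (signedStep N a)^[u + 1] g l) = _
    simp_rw [this]
    rw [sum_range_range_comm]
    refine Finset.sum_congr rfl fun m hm => ?_
    rw [← Finset.sum_mul, wOnes_succ_nat N a u (by simpa [Nat.lt_succ_iff] using hm)]

/-! ### Action of index entries and the finite evaluation -/

/-- The kernel by which an entry `c` of the index acts. -/
def stepKernel (N a c k l : ℕ) : ℝ :=
  if c = 1 then 2 ^ jump k l / lin N a k
  else (-1) ^ k / lin N a k ^ 2 * wOnes N a (c - 3) k l * ((-1) ^ l / lin N a l)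

theorem sum_starSum_div_pow_kernel {N a : ℕ} (ha : 1 ≤ a) (hN : 1 ≤ N) (g : ℕ → ℝ) (n : ℕ) {c : ℕ}
    (hc : 1 ≤ c) (hc2 : c ≠ 2) :
    ∑ m ∈ Finset.range (n + 1), starSum N a g m / lin N a m ^ c =
      starSum N a (fun k => ∑ l ∈ Finset.range (k + 1), stepKernel N a c k l * g l) n := by
  rcases eq_or_ne c 1 with rfl | h1
  · simp only [pow_one]
    rw [sum_starSum_div ha hN]
    congr 1
    funext k
    rw [jumpSum, Finset.sum_div]
    refine Finset.sum_congr rfl fun l _ => ?_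
    rw [stepKernel, if_pos rfl]
    ring
  · obtain ⟨u, rfl⟩ : ∃ u, c = u + 1 + 2 := ⟨c - 3, by omega⟩
    rw [sum_starSum_div_pow ha hN]
    congr 1
    funext k
    rw [signedStep_iterate, Finset.mul_sum, Finset.sum_div]
    refine Finset.sum_congr rfl fun l _ => ?_
    rw [stepKernel, if_neg (by omega), show u + 1 + 2 - 3 = u by omega]
    ring

/-- The finite multiple `t`-star sum over `n ≥ k₁ ≥ ⋯ ≥ k_u ≥ 0`. -/
def tStarFin (N a : ℕ) (s : List ℕ) (n : ℕ) : ℝ :=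
  ∑ k ∈ antitoneBox s.length 0 n, ∏ i, 1 / ((N : ℝ) * (k i : ℝ) + (a : ℝ)) ^ (s.get i)

theorem tStarFin_nil (N a n : ℕ) : tStarFin N a [] n = 1 := by
  unfold tStarFin
  exact (sum_antitoneBox_zero _ _ _).trans (by simp)

theorem tStarFin_cons (N a c : ℕ) (s : List ℕ) (n : ℕ) :
    tStarFin N a (c :: s) n =
      ∑ m ∈ Finset.range (n + 1), tStarFin N a s m / lin N a m ^ c := by
  unfold tStarFin
  refine (sum_antitoneBox_succ s.length 0 n _).trans ?_
  rw [Nat.range_succ_eq_Icc_zero]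
  refine Finset.sum_congr rfl fun m _ => ?_
  rw [Finset.sum_div]
  refine Finset.sum_congr rfl fun k _ => ?_
  refine (Fin.prod_univ_succ _).trans ?_
  simp [lin, div_eq_mul_inv, mul_comm]

theorem tStarFin_replicate_two {N a : ℕ} (ha : 1 ≤ a) (hN : 1 ≤ N) (s : List ℕ) (g : ℕ → ℝ)
    (h : ∀ n, tStarFin N a s n = starSum N a g n) (b n : ℕ) :
    tStarFin N a (List.replicate b 2 ++ s) n =
      starSum N a (fun k => g k / lin N a k ^ (2 * b)) n := by
  induction b generalizing n with
  | zero => simp [h]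
  | succ b ih =>
    rw [List.replicate_succ, List.cons_append, tStarFin_cons]
    simp_rw [ih]
    rw [sum_starSum_div_sq ha hN]
    congr 1
    funext k
    rw [div_div, ← pow_add]
    rfl

/-- One factor of the product in `nestedTerm`. -/
def blockFactor (N a e D u : ℕ) (p : ℤ) (m : ℕ) : ℝ :=
  (-1 : ℝ) ^ (m * D) / lin N a m ^ (2 * (e : ℤ) + 3 - (D : ℤ)) * wOnes N a u p m

theorem nestedTerm_eq (N a d : ℕ) (b : Fin (d + 1) → ℕ) (c : Fin d → ℕ) (k : Fin (d + 1) → ℕ) :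
    nestedTerm N a d b c k =
      risingTwo N a (k (Fin.last d)) / (((k (Fin.last d)).factorial : ℝ) * lin N a (k (Fin.last d)))
        * ∏ i : Fin (d + 1), blockFactor N a (b i)
            (delta (extC d c i.castSucc) + delta (extC d c i.succ))
            (extC d c i.castSucc - 3) (extK d k i.castSucc) (k i) := rfl

theorem extC_succ_succ (d : ℕ) (c : Fin (d + 1) → ℕ) (i : Fin (d + 1)) :
    extC (d + 1) c i.succ.succ = extC d (Fin.tail c) i.succ := by
  unfold extC
  rw [Fin.cons_succ, Fin.cons_succ]
  conv_lhs => rw [← Fin.cons_self_tail c]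
  rw [← Fin.cons_snoc_eq_snoc_cons, Fin.cons_succ]

theorem extC_succ_one (d : ℕ) (c : Fin (d + 1) → ℕ) :
    extC (d + 1) c (Fin.succ 0) = c 0 := by
  unfold extC
  rw [Fin.cons_succ]
  conv_lhs => rw [← Fin.cons_self_tail c]
  rw [← Fin.cons_snoc_eq_snoc_cons, Fin.cons_zero]

theorem extC_zero (d : ℕ) (c : Fin d → ℕ) : extC d c 0 = 1 := rfl

/-- The artificial index -1 always counts as a jump; this supplies the factor 2 in `unitWeight`. -/
theorem wOnes_neg_one (N a : ℕ) (m : ℕ) : wOnes N a 0 (-1) m = 2 := by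
  rw [wOnes_zero]
  have : (-1 : ℤ) ≠ m := by omega
  simp [jump, this]

/-- Peeling off the largest index k: its factor is absorbed into the kernel of c, and l takes its
place as leading index, with previous entry 1 and previous index -1. This makes induction on d
possible. -/
theorem blockFactor_mul_blockFactor (N : ℕ) {a : ℕ} (ha : 1 ≤ a) (e e' c D k l : ℕ) (hc : 1 ≤ c)
    (hc2 : c ≠ 2) :
    blockFactor N a e (1 + delta c) 0 (-1) k * blockFactor N a e' (delta c + D) (c - 3) k l =
      stepKernel N a c k l / lin N a k ^ (2 * e) * blockFactor N a e' (1 + D) 0 (-1) l := by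
  have hk := lin_pos N ha k
  have hl := lin_pos N ha l
  unfold blockFactor
  rw [wOnes_neg_one, wOnes_neg_one]
  rcases eq_or_ne c 1 with rfl | h1
  · have h2 : (2 * (e : ℤ) + 3 - ((1 + delta 1 : ℕ) : ℤ)) = ((2 * e + 1 : ℕ) : ℤ) := by
      simp [delta]; ring
    rw [h2, zpow_natCast, stepKernel, if_pos rfl]
    have h3 : (-1 : ℝ) ^ (k * (1 + delta 1)) = 1 := by
      simp [delta]
    rw [h3, show 1 - 3 = 0 from rfl, wOnes_zero]
    simp only [delta]
    field_simp
    ring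
  · have hd : delta c = 0 := by
      obtain ⟨u, rfl⟩ : ∃ u, c = u + 3 := ⟨c - 3, by omega⟩
      rfl
    have h2 : (2 * (e : ℤ) + 3 - ((1 + 0 : ℕ) : ℤ)) = ((2 * e + 2 : ℕ) : ℤ) := by
      push_cast; ring
    -- Replacing δ(c) = 0 by δ(1) = 1 lowers the exponent by one, compensating the factor 1/(Nl+a)
    -- of the kernel.
    have h4 : (2 * (e' : ℤ) + 3 - ((1 + D : ℕ) : ℤ)) = (2 * (e' : ℤ) + 3 - ((0 + D : ℕ) : ℤ)) - 1 := by
      push_cast; ring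
    rw [hd, h2, h4, zpow_natCast, zpow_sub_one₀ hl.ne', stepKernel, if_neg h1]
    have h3 : ((-1 : ℝ) ^ l) * (-1) ^ l = 1 := by rw [← mul_pow]; simp
    have hz := zpow_pos hl (2 * (e' : ℤ) + 3 - ((0 + D : ℕ) : ℤ))
    rw [zero_add] at hz ⊢
    rw [mul_add, pow_add, mul_add, pow_add]
    simp only [mul_one, mul_zero, pow_zero]
    field_simp
    linear_combination (-(-1) ^ (l * D) * wOnes N a (c - 3) k l) * h3

theorem nestedTerm_succ (N : ℕ) {a : ℕ} (ha : 1 ≤ a) (d : ℕ) (b : Fin (d + 2) → ℕ)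
    (c : Fin (d + 1) → ℕ) (hc : 1 ≤ c 0 ∧ c 0 ≠ 2) (k : Fin (d + 2) → ℕ) :
    nestedTerm N a (d + 1) b c k =
      stepKernel N a (c 0) (k 0) (k 1) / lin N a (k 0) ^ (2 * b 0) *
        nestedTerm N a d (Fin.tail b) (Fin.tail c) (Fin.tail k) := by
  rw [nestedTerm_eq, nestedTerm_eq, Fin.prod_univ_succ, Fin.prod_univ_succ,
    Fin.prod_univ_succ (n := d)]
  simp only [← Fin.succ_castSucc, Fin.castSucc_zero, extC_succ_succ, extC_succ_one, extC_zero]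
  have key := blockFactor_mul_blockFactor N ha (b 0) (b 1) (c 0)
    (delta (extC d (Fin.tail c) (Fin.succ 0))) (k 0) (k 1) hc.1 hc.2
  have hl : k (Fin.last (d + 1)) = Fin.tail k (Fin.last d) := rfl
  rw [← hl]
  have aux : ∀ P R f₀ f₁ K f : ℝ, f₀ * f₁ = K * f → P * (f₀ * (f₁ * R)) = K * (P * (f * R)) := by
    intro P R f₀ f₁ K f h
    linear_combination (P * R) * h
  exact aux _ _ _ _ _ _ key

/-- The part of the nested sum with largest entry `k`. -/
def nestedFiber (N a d : ℕ) (b : Fin (d + 1) → ℕ) (c : Fin d → ℕ) (k : ℕ) : ℝ :=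
  ∑ l ∈ antitoneBox d 0 k, nestedTerm N a d b c (Fin.cons k l)

/-- The absolute version of `nestedFiber`. -/
def nestedFiberAbs (N a d : ℕ) (b : Fin (d + 1) → ℕ) (c : Fin d → ℕ) (k : ℕ) : ℝ :=
  ∑ l ∈ antitoneBox d 0 k, |nestedTerm N a d b c (Fin.cons k l)|

theorem nestedTerm_zero (N a : ℕ) (b : Fin 1 → ℕ) (c : Fin 0 → ℕ) (k : ℕ) (l : Fin 0 → ℕ) :
    nestedTerm N a 0 b c (Fin.cons k l) =
      2 * ((-1) ^ k * (risingTwo N a k / (k.factorial * lin N a k))) / lin N a k ^ (2 * b 0) := by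
  rw [nestedTerm_eq, Fin.prod_univ_succ, Fin.prod_univ_zero, mul_one]
  change risingTwo N a k / (k.factorial * lin N a k) *
    blockFactor N a (b 0) (delta 1 + delta 0) 0 (-1) k = _
  have h : (2 * (b 0 : ℤ) + 3 - ((delta 1 + delta 0 : ℕ) : ℤ)) = ((2 * b 0 : ℕ) : ℤ) := by
    simp [delta]
  unfold blockFactor
  rw [wOnes_neg_one, h, zpow_natCast]
  have h3 : (-1 : ℝ) ^ (k * (delta 1 + delta 0)) = (-1) ^ k := by
    rw [mul_comm, pow_mul]; simp [delta, pow_succ]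
  rw [h3]
  ring

theorem nestedFiber_zero (N a : ℕ) (b : Fin 1 → ℕ) (c : Fin 0 → ℕ) (k : ℕ) :
    nestedFiber N a 0 b c k =
      2 * ((-1) ^ k * (risingTwo N a k / (k.factorial * lin N a k))) / lin N a k ^ (2 * b 0) :=
  (sum_antitoneBox_zero _ _ _).trans (nestedTerm_zero N a b c k _)

theorem nestedFiber_succ (N : ℕ) {a : ℕ} (ha : 1 ≤ a) (d : ℕ) (b : Fin (d + 2) → ℕ)
    (c : Fin (d + 1) → ℕ) (hc : 1 ≤ c 0 ∧ c 0 ≠ 2) (k : ℕ) :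
    nestedFiber N a (d + 1) b c k =
      (∑ l ∈ Finset.range (k + 1), stepKernel N a (c 0) k l *
        nestedFiber N a d (Fin.tail b) (Fin.tail c) l) / lin N a k ^ (2 * b 0) := by
  unfold nestedFiber
  rw [sum_antitoneBox_succ, Nat.range_succ_eq_Icc_zero, Finset.sum_div]
  refine Finset.sum_congr rfl fun l _ => ?_
  rw [Finset.mul_sum, Finset.sum_div]
  refine Finset.sum_congr rfl fun f _ => ?_
  rw [nestedTerm_succ N ha d b c hc, Fin.tail_cons]
  change stepKernel N a (c 0) k l / _ * _ = _
  rw [Fin.cons_zero]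
  ring

theorem nestedFiberAbs_succ (N : ℕ) {a : ℕ} (ha : 1 ≤ a) (d : ℕ) (b : Fin (d + 2) → ℕ)
    (c : Fin (d + 1) → ℕ) (hc : 1 ≤ c 0 ∧ c 0 ≠ 2) (k : ℕ) :
    nestedFiberAbs N a (d + 1) b c k =
      (∑ l ∈ Finset.range (k + 1), |stepKernel N a (c 0) k l| *
        nestedFiberAbs N a d (Fin.tail b) (Fin.tail c) l) / lin N a k ^ (2 * b 0) := by
  unfold nestedFiberAbs
  rw [sum_antitoneBox_succ, Nat.range_succ_eq_Icc_zero, Finset.sum_div]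
  refine Finset.sum_congr rfl fun l _ => ?_
  rw [Finset.mul_sum, Finset.sum_div]
  refine Finset.sum_congr rfl fun f _ => ?_
  rw [nestedTerm_succ N ha d b c hc, Fin.tail_cons]
  change |stepKernel N a (c 0) k l / lin N a k ^ _ * _| = _
  rw [abs_mul, abs_div, abs_of_pos (pow_pos (lin_pos N ha k) _)]
  ring

theorem blockIndex_succ (d : ℕ) (b : Fin (d + 2) → ℕ) (c : Fin (d + 1) → ℕ) :
    blockIndex (d + 1) b c =
      List.replicate (b 0) 2 ++ (c 0 :: blockIndex d (Fin.tail b) (Fin.tail c)) := by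
  unfold blockIndex
  rw [List.ofFn_succ, List.flatten_cons]
  rfl

theorem blockIndex_zero (b : Fin 1 → ℕ) (c : Fin 0 → ℕ) :
    blockIndex 0 b c = List.replicate (b 0) 2 ++ [] := by
  simp [blockIndex]

/-- The finite form of the evaluation. -/
theorem tStarFin_blockIndex {N a : ℕ} (ha : 1 ≤ a) (hN : 1 ≤ N) (d : ℕ) (b : Fin (d + 1) → ℕ)
    (c : Fin d → ℕ) (hc : ∀ i, 1 ≤ c i ∧ c i ≠ 2) (n : ℕ) :
    tStarFin N a (blockIndex d b c) n =
      starSum N a (fun k => N * nestedFiber N a d b c k) n := by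
  induction d generalizing n with
  | zero =>
    rw [blockIndex_zero, tStarFin_replicate_two ha hN [] (unitWeight N a) fun n => by
      rw [tStarFin_nil, starSum_unitWeight ha hN]]
    congr 1
    funext k
    rw [nestedFiber_zero, unitWeight]
    ring
  | succ d ih =>
    rw [blockIndex_succ, tStarFin_replicate_two ha hN _ (fun k => ∑ l ∈ Finset.range (k + 1),
      stepKernel N a (c 0) k l * (N * nestedFiber N a d (Fin.tail b) (Fin.tail c) l)) fun n => ?_]
    · congr 1
      funext k
      rw [nestedFiber_succ N ha d b c (hc 0), ← mul_div_assoc, Finset.mul_sum]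
      congr 1
      exact Finset.sum_congr rfl fun l _ => by ring
    · rw [tStarFin_cons, ← sum_starSum_div_pow_kernel ha hN _ _ (hc 0).1 (hc 0).2]
      exact Finset.sum_congr rfl fun m _ => by
        rw [ih (Fin.tail b) (Fin.tail c) fun i => hc i.succ]

/-! ### Box sums and unconditional sums over decreasing tuples -/

open Classical in
/-- `antitoneBox` as a finite set of weakly decreasing tuples. -/
def antitoneBoxSubtype (u n : ℕ) : Finset {k : Fin u → ℕ // Antitone k} :=
  (antitoneBox u 0 n).subtype Antitone

theorem mem_antitoneBoxSubtype {u n : ℕ} {k : {k : Fin u → ℕ // Antitone k}} :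
    k ∈ antitoneBoxSubtype u n ↔ ∀ i, k.1 i ≤ n := by
  simp [antitoneBoxSubtype, mem_antitoneBox, k.2]

theorem sum_antitoneBoxSubtype (u n : ℕ) (F : (Fin u → ℕ) → ℝ) :
    ∑ k ∈ antitoneBoxSubtype u n, F k.1 = ∑ k ∈ antitoneBox u 0 n, F k := by
  classical
  unfold antitoneBoxSubtype
  rw [Finset.sum_subtype_eq_sum_filter, Finset.filter_true_of_mem]
  exact fun k hk => (mem_antitoneBox.1 hk).2

theorem tendsto_antitoneBoxSubtype (u : ℕ) : Tendsto (antitoneBoxSubtype u) atTop atTop := by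
  refine tendsto_atTop_finset_of_monotone (fun m n h k hk => ?_) fun k => ?_
  · rw [mem_antitoneBoxSubtype] at hk ⊢
    exact fun i => (hk i).trans h
  -- The sum of the entries bounds each entry, also for the empty tuple.
  · refine ⟨∑ i, k.1 i, mem_antitoneBoxSubtype.2 fun i => ?_⟩
    exact Finset.single_le_sum (fun _ _ => Nat.zero_le _) (Finset.mem_univ i)

theorem summable_of_antitoneBox_le {u : ℕ} {F : (Fin u → ℕ) → ℝ} {K : ℝ}
    (h : ∀ n, ∑ k ∈ antitoneBox u 0 n, |F k| ≤ K) :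
    Summable fun k : {k : Fin u → ℕ // Antitone k} => F k.1 := by
  refine Summable.of_abs (summable_of_sum_le (fun _ => abs_nonneg _) (c := K) fun s => ?_)
  obtain ⟨n, hn⟩ := ((tendsto_antitoneBoxSubtype u).eventually_ge_atTop s).exists
  refine (Finset.sum_le_sum_of_subset_of_nonneg hn fun _ _ _ => abs_nonneg _).trans ?_
  exact (sum_antitoneBoxSubtype u n fun k => |F k|).trans_le (h n)

theorem tendsto_sum_antitoneBox {u : ℕ} {F : (Fin u → ℕ) → ℝ} {S : ℝ}
    (h : HasSum (fun k : {k : Fin u → ℕ // Antitone k} => F k.1) S) :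
    Tendsto (fun n => ∑ k ∈ antitoneBox u 0 n, F k) atTop (𝓝 S) := by
  simp_rw [← sum_antitoneBoxSubtype]
  have h' : Tendsto (fun s : Finset {k : Fin u → ℕ // Antitone k} => ∑ k ∈ s, F k.1)
      atTop (𝓝 S) := by simpa [HasSum] using h
  exact h'.comp (tendsto_antitoneBoxSubtype u)

theorem sum_antitoneBox_nestedTerm (N a d : ℕ) (b : Fin (d + 1) → ℕ) (c : Fin d → ℕ) (n : ℕ) :
    ∑ k ∈ antitoneBox (d + 1) 0 n, nestedTerm N a d b c k =
      ∑ k ∈ Finset.range (n + 1), nestedFiber N a d b c k := by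
  rw [sum_antitoneBox_succ, Nat.range_succ_eq_Icc_zero]
  rfl

theorem nestedPartialSum_eq (N a d : ℕ) (b : Fin (d + 1) → ℕ) (c : Fin d → ℕ) (n : ℕ) :
    nestedPartialSum N a d b c n = ∑ k ∈ antitoneBox (d + 1) 0 n, nestedTerm N a d b c k := by
  unfold nestedPartialSum antitoneBox
  rw [Nat.range_succ_eq_Icc_zero]

/-! ### Logarithmic bounds and absolute convergence -/

/-- A logarithmic bound for the partial sums of the harmonic series. -/
def logWeight (k : ℕ) : ℝ := 1 + Real.log ((k + 1 : ℕ) : ℝ)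

theorem one_le_logWeight (k : ℕ) : 1 ≤ logWeight k := by
  have := Real.log_natCast_nonneg (k + 1)
  unfold logWeight; linarith

theorem logWeight_mono : Monotone logWeight := by
  intro k l h
  unfold logWeight
  have : Real.log ((k + 1 : ℕ) : ℝ) ≤ Real.log ((l + 1 : ℕ) : ℝ) :=
    Real.log_le_log (by positivity) (by exact_mod_cast Nat.succ_le_succ h)
  linarith

theorem sum_inv_lin_le {N a : ℕ} (ha : 1 ≤ a) (hN : 1 ≤ N) (k : ℕ) :
    ∑ l ∈ Finset.range (k + 1), 1 / lin N a l ≤ logWeight k := by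
  refine le_trans ?_ (harmonic_le_one_add_log (k + 1))
  unfold harmonic
  push_cast
  refine Finset.sum_le_sum fun l _ => ?_
  rw [one_div]
  exact inv_anti₀ (by positivity) (succ_le_lin ha hN l)

theorem two_pow_jump_le (k m : ℤ) : (2 : ℝ) ^ jump k m ≤ 2 := by
  unfold jump; split_ifs <;> norm_num

/-- Each inner index costs a jump factor at most 2 and a harmonic sum. -/
theorem wOnes_le {N a : ℕ} (ha : 1 ≤ a) (hN : 1 ≤ N) (u : ℕ) {k m : ℕ} (h : m ≤ k) :
    wOnes N a u k m ≤ 2 * (2 * logWeight k) ^ u := by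
  induction u generalizing k with
  | zero => rw [wOnes_zero]; simpa using two_pow_jump_le k m
  | succ u ih =>
    rw [wOnes_succ_nat N a u h]
    have hL := one_le_logWeight k
    calc ∑ x ∈ Finset.Ico m (k + 1), 2 ^ jump k x / lin N a x * wOnes N a u x m
        ≤ ∑ x ∈ Finset.Ico m (k + 1), 1 / lin N a x * (2 * (2 * (2 * logWeight k) ^ u)) := by
          refine Finset.sum_le_sum fun x hx => ?_
          rw [Finset.mem_Ico] at hx
          have hx0 := lin_pos N ha x
          have h1 := ih hx.1
          have h2 : logWeight x ≤ logWeight k := logWeight_mono (by omega)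
          have h3 := one_le_logWeight x
          have h4 : (2 * logWeight x) ^ u ≤ (2 * logWeight k) ^ u :=
            pow_le_pow_left₀ (by linarith) (by linarith) u
          rw [div_mul_eq_mul_div, div_mul_eq_mul_div, one_mul]
          refine div_le_div_of_nonneg_right ?_ hx0.le
          exact mul_le_mul (two_pow_jump_le _ _) (by linarith) (wOnes_nonneg N ha u hx.1)
            (by norm_num)
      _ ≤ ∑ x ∈ Finset.range (k + 1), 1 / lin N a x * (2 * (2 * (2 * logWeight k) ^ u)) := by
          refine Finset.sum_le_sum_of_subset_of_nonneg ?_ fun x _ _ => ?_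
          · intro x hx
            rw [Finset.mem_Ico] at hx
            exact Finset.mem_range.2 hx.2
          · have := lin_pos N ha x
            positivity
      _ ≤ logWeight k * (2 * (2 * (2 * logWeight k) ^ u)) := by
          rw [← Finset.sum_mul]
          exact mul_le_mul_of_nonneg_right (sum_inv_lin_le ha hN k) (by positivity)
      _ = 2 * (2 * logWeight k) ^ (u + 1) := by ring

/-- The k+1 summands are absorbed by 1/(Nk+a): no logarithm is lost, but no decay is gained. -/
theorem sum_stepKernel_one_le {N a : ℕ} (ha : 1 ≤ a) (hN : 1 ≤ N) {h : ℕ → ℝ} {K : ℝ} (hK : 0 ≤ K)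
    {M : ℕ} (hh : ∀ l, h l ≤ K * logWeight l ^ M) (k : ℕ) :
    ∑ l ∈ Finset.range (k + 1), |stepKernel N a 1 k l| * h l ≤ 2 * K * logWeight k ^ M := by
  have hk := lin_pos N ha k
  have hL := one_le_logWeight k
  calc ∑ l ∈ Finset.range (k + 1), |stepKernel N a 1 k l| * h l
      ≤ ∑ l ∈ Finset.range (k + 1), 2 / lin N a k * (K * logWeight k ^ M) := by
        refine Finset.sum_le_sum fun l hl => ?_
        rw [Finset.mem_range] at hl
        have h1 : |stepKernel N a 1 k l| ≤ 2 / lin N a k := by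
          rw [stepKernel, if_pos rfl, abs_of_nonneg (by positivity)]
          exact div_le_div_of_nonneg_right (two_pow_jump_le _ _) hk.le
        have h2 : h l ≤ K * logWeight k ^ M := (hh l).trans <|
          mul_le_mul_of_nonneg_left (pow_le_pow_left₀ (by linarith [one_le_logWeight l])
            (logWeight_mono (by omega)) M) hK
        exact (mul_le_mul_of_nonneg_left h2 (abs_nonneg _)).trans
          (mul_le_mul_of_nonneg_right h1 (by positivity))
    _ = ((k : ℝ) + 1) / lin N a k * (2 * K * logWeight k ^ M) := by
        rw [Finset.sum_const, Finset.card_range, nsmul_eq_mul]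
        push_cast
        ring
    _ ≤ 1 * (2 * K * logWeight k ^ M) := by
        refine mul_le_mul_of_nonneg_right ?_ (by positivity)
        exact (div_le_one hk).2 (succ_le_lin ha hN k)
    _ = _ := one_mul _

/-- W^# contributes c-3 logarithms and the sum of 1/(Nl+a) one more, while the decay (Nk+a)⁻²
survives. -/
theorem sum_stepKernel_le {N a : ℕ} (ha : 1 ≤ a) (hN : 1 ≤ N) {h : ℕ → ℝ} {K : ℝ} (hK : 0 ≤ K)
    {M : ℕ} (hh : ∀ l, h l ≤ K * logWeight l ^ M) {c : ℕ} (hc : c ≠ 1) (k : ℕ) :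
    ∑ l ∈ Finset.range (k + 1), |stepKernel N a c k l| * h l ≤
      2 * 2 ^ (c - 3) * K * logWeight k ^ (c - 3 + M + 1) / lin N a k ^ 2 := by
  have hk := lin_pos N ha k
  have hL := one_le_logWeight k
  calc ∑ l ∈ Finset.range (k + 1), |stepKernel N a c k l| * h l
      ≤ ∑ l ∈ Finset.range (k + 1), 1 / lin N a l *
          (2 * (2 * logWeight k) ^ (c - 3) / lin N a k ^ 2 * (K * logWeight k ^ M)) := by
        refine Finset.sum_le_sum fun l hl => ?_
        rw [Finset.mem_range] at hl
        have hl0 := lin_pos N ha l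
        have hlk : l ≤ k := by omega
        have h1 : |stepKernel N a c k l| ≤
            1 / lin N a l * (2 * (2 * logWeight k) ^ (c - 3) / lin N a k ^ 2) := by
          rw [stepKernel, if_neg hc]
          simp only [abs_mul, abs_div, abs_pow, abs_neg, abs_one, one_pow]
          rw [abs_of_pos hl0, abs_of_pos hk, abs_of_nonneg (wOnes_nonneg N ha _ hlk), mul_comm]
          refine mul_le_mul_of_nonneg_left ?_ (by positivity)
          rw [div_mul_eq_mul_div, one_mul]
          exact div_le_div_of_nonneg_right (wOnes_le ha hN _ hlk) (by positivity)
        have h2 : h l ≤ K * logWeight k ^ M := (hh l).trans <|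
          mul_le_mul_of_nonneg_left (pow_le_pow_left₀ (by linarith [one_le_logWeight l])
            (logWeight_mono hlk) M) hK
        rw [← mul_assoc]
        exact (mul_le_mul_of_nonneg_left h2 (abs_nonneg _)).trans
          (mul_le_mul_of_nonneg_right h1 (by positivity))
    _ ≤ logWeight k *
          (2 * (2 * logWeight k) ^ (c - 3) / lin N a k ^ 2 * (K * logWeight k ^ M)) := by
        rw [← Finset.sum_mul]
        exact mul_le_mul_of_nonneg_right (sum_inv_lin_le ha hN k) (by positivity)
    _ = _ := by rw [mul_pow, pow_succ, pow_add]; ring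

/-- The quotient `(2a/N)_k / (k! (N k + a))`. -/
def risingRatio (N a k : ℕ) : ℝ := risingTwo N a k / (k.factorial * lin N a k)

theorem risingRatio_pos {N a : ℕ} (ha : 1 ≤ a) (hN : 1 ≤ N) (k : ℕ) : 0 < risingRatio N a k := by
  have := risingTwo_pos ha hN k
  have := lin_pos N ha k
  unfold risingRatio; positivity

theorem risingRatio_antitone {N a : ℕ} (ha : 1 ≤ a) (haN : a ≤ N) :
    Antitone (risingRatio N a) := by
  refine antitone_nat_of_succ_le fun k => ?_
  have hN : 1 ≤ N := ha.trans haN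
  have hN' : (0 : ℝ) < N := by exact_mod_cast hN
  have ha' : (0 : ℝ) < a := by exact_mod_cast ha
  have haN' : (a : ℝ) ≤ N := by exact_mod_cast haN
  have hk : (0 : ℝ) ≤ k := k.cast_nonneg
  have p := risingTwo_pos ha hN k
  have s := risingTwo_succ a hN k
  have hs : risingTwo N a (k + 1) = risingTwo N a k * (2 * a + N * k) / N := by
    field_simp; linarith
  have hf : (0 : ℝ) < (k.factorial : ℝ) := by exact_mod_cast k.factorial_pos
  have h1 := lin_pos N ha k
  have h2 := lin_pos N ha (k + 1)
  have key : (2 * a + N * k) * lin N a k ≤ N * ((k : ℝ) + 1) * lin N a (k + 1) := by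
    -- The difference of the two sides of `key` is (N-a)(N+2a) + 2(N-a)Nk.
    have h3 : (0 : ℝ) ≤ (N - a) * (N + 2 * a) := mul_nonneg (by linarith) (by linarith)
    have h4 : (0 : ℝ) ≤ (N - a) * (N * k) := mul_nonneg (by linarith) (by positivity)
    unfold lin
    push_cast
    nlinarith
  unfold risingRatio
  rw [hs, Nat.factorial_succ]
  push_cast
  rw [div_div, div_le_div_iff₀ (by positivity) (by positivity)]
  have := mul_le_mul_of_nonneg_left key (mul_pos p hf).le
  linarith

theorem nestedFiberAbs_zero {N a : ℕ} (ha : 1 ≤ a) (hN : 1 ≤ N) (b : Fin 1 → ℕ) (c : Fin 0 → ℕ)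
    (k : ℕ) : nestedFiberAbs N a 0 b c k = 2 * risingRatio N a k / lin N a k ^ (2 * b 0) := by
  refine (sum_antitoneBox_zero _ _ _).trans ?_
  have h1 := lin_pos N ha k
  have h2 := risingRatio_pos ha hN k
  rw [nestedTerm_zero]
  change |2 * ((-1) ^ k * risingRatio N a k) / lin N a k ^ (2 * b 0)| = _
  rw [abs_div, abs_mul, abs_mul, abs_pow, abs_neg, abs_one, one_pow, one_mul, abs_of_pos h2,
    abs_of_pos (pow_pos h1 _), abs_two]

theorem div_pow_lin_le {N a : ℕ} (ha : 1 ≤ a) (hN : 1 ≤ N) {K : ℝ} (hK : 0 ≤ K) (k i : ℕ) :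
    K / lin N a k ^ i ≤ K := by
  refine div_le_self hK (one_le_pow₀ ?_)
  have := succ_le_lin ha hN k
  have hk : (0 : ℝ) ≤ k := k.cast_nonneg
  linarith

theorem nestedFiberAbs_nonneg (N a d : ℕ) (b : Fin (d + 1) → ℕ) (c : Fin d → ℕ) (k : ℕ) :
    0 ≤ nestedFiberAbs N a d b c k := Finset.sum_nonneg fun _ _ => abs_nonneg _

theorem nestedFiberAbs_le {N a : ℕ} (ha : 1 ≤ a) (haN : a ≤ N) (d : ℕ) (b : Fin (d + 1) → ℕ)
    (c : Fin d → ℕ) (hc : ∀ i, 1 ≤ c i ∧ c i ≠ 2) :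
    ∃ K : ℝ, 0 ≤ K ∧ ∃ M : ℕ, ∀ k,
      nestedFiberAbs N a d b c k ≤ K * logWeight k ^ M / lin N a k ^ (2 * b 0) := by
  have hN : 1 ≤ N := ha.trans haN
  induction d with
  | zero =>
    refine ⟨2 * risingRatio N a 0, ?_, 0, fun k => ?_⟩
    · have := risingRatio_pos ha hN 0
      positivity
    · have hk := lin_pos N ha k
      rw [nestedFiberAbs_zero ha hN, pow_zero, mul_one]
      refine div_le_div_of_nonneg_right ?_ (by positivity)
      linarith [risingRatio_antitone ha haN (Nat.zero_le k)]
  | succ d ih =>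
    obtain ⟨K, hK, M, h⟩ := ih (Fin.tail b) (Fin.tail c) fun i => hc i.succ
    have h' : ∀ k, nestedFiberAbs N a d (Fin.tail b) (Fin.tail c) k ≤ K * logWeight k ^ M :=
      fun k => (h k).trans <| div_pow_lin_le ha hN
        (mul_nonneg hK (pow_nonneg (by linarith [one_le_logWeight k]) M)) k _
    rcases eq_or_ne (c 0) 1 with h1 | h1
    · refine ⟨2 * K, by positivity, M, fun k => ?_⟩
      have hk := lin_pos N ha k
      rw [nestedFiberAbs_succ N ha d b c (hc 0), h1]
      exact div_le_div_of_nonneg_right (sum_stepKernel_one_le ha hN hK h' k) (by positivity)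
    · refine ⟨2 * 2 ^ (c 0 - 3) * K, by positivity, c 0 - 3 + M + 1, fun k => ?_⟩
      have hk := lin_pos N ha k
      have hL := one_le_logWeight k
      rw [nestedFiberAbs_succ N ha d b c (hc 0)]
      refine div_le_div_of_nonneg_right ?_ (by positivity)
      exact (sum_stepKernel_le ha hN hK h' h1 k).trans (div_pow_lin_le ha hN (by positivity) k 2)

/-- Quadratic decay comes either from the power 2b₀ or, when b₀ = 0, from the kernel of c₁ ≥ 3. -/
theorem nestedFiberAbs_le_sq {N a : ℕ} (ha : 1 ≤ a) (haN : a ≤ N) (d : ℕ) (b : Fin (d + 1) → ℕ)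
    (c : Fin d → ℕ) (hc : ∀ i, 1 ≤ c i ∧ c i ≠ 2)
    (hc1 : ∀ hd : 0 < d, b 0 = 0 → 3 ≤ c ⟨0, hd⟩) (hdb : 1 ≤ d ∨ 1 ≤ b 0) :
    ∃ K : ℝ, 0 ≤ K ∧ ∃ M : ℕ, ∀ k,
      nestedFiberAbs N a d b c k ≤ K * logWeight k ^ M / lin N a k ^ 2 := by
  have hN : 1 ≤ N := ha.trans haN
  rcases Nat.eq_zero_or_pos (b 0) with h0 | h0
  · obtain ⟨d, rfl⟩ : ∃ e, d = e + 1 := ⟨d - 1, by omega⟩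
    have h3 : 3 ≤ c 0 := hc1 (Nat.succ_pos d) h0
    obtain ⟨K, hK, M, h⟩ := nestedFiberAbs_le ha haN d (Fin.tail b) (Fin.tail c) fun i => hc i.succ
    have h' : ∀ k, nestedFiberAbs N a d (Fin.tail b) (Fin.tail c) k ≤ K * logWeight k ^ M :=
      fun k => (h k).trans <| div_pow_lin_le ha hN
        (mul_nonneg hK (pow_nonneg (by linarith [one_le_logWeight k]) M)) k _
    refine ⟨2 * 2 ^ (c 0 - 3) * K, by positivity, c 0 - 3 + M + 1, fun k => ?_⟩
    rw [nestedFiberAbs_succ N ha d b c (hc 0), h0, mul_zero, pow_zero, div_one]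
    exact sum_stepKernel_le ha hN hK h' (by omega) k
  · obtain ⟨K, hK, M, h⟩ := nestedFiberAbs_le ha haN d b c hc
    refine ⟨K, hK, M, fun k => (h k).trans ?_⟩
    have hk := lin_pos N ha k
    have hL := one_le_logWeight k
    rw [show 2 * b 0 = 2 + (2 * b 0 - 2) by omega, pow_add, ← div_div]
    exact div_pow_lin_le ha hN (by positivity) k _

theorem summable_logWeight_div_sq {N a : ℕ} (ha : 1 ≤ a) (hN : 1 ≤ N) (M : ℕ) :
    Summable fun k => logWeight k ^ M / lin N a k ^ 2 := by
  -- Chosen so that εM ≤ 1/2: the logarithms then cost at most t^(1/2), leaving the summable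
  -- t^(-3/2).
  set ε : ℝ := 1 / (2 * (M + 1)) with hε
  have hε0 : 0 < ε := by positivity
  have hs : Summable fun k : ℕ => (1 + 1 / ε) ^ M * ((k + 1 : ℕ) : ℝ) ^ (-(3 / 2) : ℝ) :=
    ((summable_nat_add_iff 1).2 (Real.summable_nat_rpow.2 (by norm_num))).mul_left _
  refine Summable.of_nonneg_of_le (fun k => ?_) (fun k => ?_) hs
  · have := lin_pos N ha k
    have := one_le_logWeight k
    positivity
  · have ht : (1 : ℝ) ≤ ((k + 1 : ℕ) : ℝ) := by exact_mod_cast Nat.succ_pos k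
    have hlin : ((k + 1 : ℕ) : ℝ) ≤ lin N a k := by push_cast; exact succ_le_lin ha hN k
    set t : ℝ := ((k + 1 : ℕ) : ℝ) with htdef
    have ht0 : 0 < t := by linarith
    have h1 : logWeight k ≤ (1 + 1 / ε) * t ^ ε := by
      have h2 := Real.log_le_rpow_div ht0.le hε0
      have h3 : 1 ≤ t ^ ε := Real.one_le_rpow ht hε0.le
      unfold logWeight
      rw [← htdef, add_mul, one_mul, one_div_mul_eq_div]
      linarith
    have hM : ε * M ≤ 1 / 2 := by
      have : (0 : ℝ) ≤ M := M.cast_nonneg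
      rw [hε, div_mul_eq_mul_div, div_le_div_iff₀ (by positivity) (by norm_num)]
      linarith
    have h4 : logWeight k ^ M ≤ (1 + 1 / ε) ^ M * t ^ (1 / 2 : ℝ) := by
      refine (pow_le_pow_left₀ (by linarith [one_le_logWeight k]) h1 M).trans ?_
      rw [mul_pow]
      refine mul_le_mul_of_nonneg_left ?_ (by positivity)
      rw [← Real.rpow_natCast, ← Real.rpow_mul ht0.le]
      exact Real.rpow_le_rpow_of_exponent_le ht hM
    calc logWeight k ^ M / lin N a k ^ 2
        ≤ (1 + 1 / ε) ^ M * t ^ (1 / 2 : ℝ) / t ^ 2 :=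
          div_le_div₀ (by positivity) h4 (by positivity) (pow_le_pow_left₀ ht0.le hlin 2)
      _ = (1 + 1 / ε) ^ M * t ^ (-(3 / 2) : ℝ) := by
          rw [mul_div_assoc, ← Real.rpow_two, ← Real.rpow_sub ht0]
          norm_num

theorem summable_nestedFiberAbs {N a : ℕ} (ha : 1 ≤ a) (haN : a ≤ N) (d : ℕ)
    (b : Fin (d + 1) → ℕ) (c : Fin d → ℕ) (hc : ∀ i, 1 ≤ c i ∧ c i ≠ 2)
    (hc1 : ∀ hd : 0 < d, b 0 = 0 → 3 ≤ c ⟨0, hd⟩) (hdb : 1 ≤ d ∨ 1 ≤ b 0) :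
    Summable (nestedFiberAbs N a d b c) := by
  obtain ⟨K, -, M, h⟩ := nestedFiberAbs_le_sq ha haN d b c hc hc1 hdb
  refine Summable.of_nonneg_of_le (nestedFiberAbs_nonneg N a d b c) h ?_
  simp_rw [mul_div_assoc]
  exact (summable_logWeight_div_sq ha (ha.trans haN) M).mul_left K

/-! ### Limits of the transform: dominated and alternating cases -/

theorem tendsto_starSum {N a : ℕ} (ha : 1 ≤ a) (hN : 1 ≤ N) {g : ℕ → ℝ} (hg : Summable g) :
    Tendsto (starSum N a g) atTop
      (𝓝 (1 / ProbabilityTheory.beta ((a : ℝ) / N) ((a : ℝ) / N) * ∑' k, g k)) := by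
  obtain ⟨K, hK⟩ := starCoeff_le ha hN
  have e : starSum N a g = fun n => ∑' k, starCoeff N a n k * g k := by
    funext n
    refine (tsum_eq_sum fun k hk => ?_).symm
    rw [starCoeff_of_lt (by simpa [Nat.succ_le_iff] using hk), zero_mul]
  rw [e, ← tsum_mul_left]
  refine tendsto_tsum_of_dominated_convergence (hg.abs.mul_left K)
    (fun k => (tendsto_starCoeff ha hN k).mul_const _) (Eventually.of_forall fun n k => ?_)
  rw [Real.norm_eq_abs, abs_mul, abs_of_nonneg (starCoeff_nonneg ha hN n k)]
  exact mul_le_mul_of_nonneg_right (hK n k) (abs_nonneg _)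

theorem alternating_sum_mem_Icc {g : ℕ → ℝ} (hg : Antitone g) (h0 : ∀ k, 0 ≤ g k) (p m : ℕ) :
    ∑ i ∈ Finset.range m, (-1) ^ i * g (p + i) ∈ Set.Icc 0 (g p) := by
  induction m generalizing p with
  | zero => simpa using h0 p
  | succ m ih =>
    have e : ∑ i ∈ Finset.range (m + 1), (-1) ^ i * g (p + i) =
        g p - ∑ i ∈ Finset.range m, (-1) ^ i * g (p + 1 + i) := by
      rw [Finset.sum_range_succ', add_comm, sub_eq_add_neg, ← Finset.sum_neg_distrib]
      congr 1
      · simp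
      · refine Finset.sum_congr rfl fun i _ => ?_
        rw [pow_succ, show p + (i + 1) = p + 1 + i by omega]
        ring
    have := ih (p + 1)
    have h1 := hg (Nat.le_succ p)
    rw [e]
    exact ⟨by linarith [this.2], by linarith [this.1]⟩

theorem abs_alternating_sum_Ico_le {g : ℕ → ℝ} (hg : Antitone g) (h0 : ∀ k, 0 ≤ g k) (p q : ℕ) :
    |∑ k ∈ Finset.Ico p q, (-1) ^ k * g k| ≤ g p := by
  have h := alternating_sum_mem_Icc hg h0 p (q - p)
  rw [Finset.sum_Ico_eq_sum_range]
  simp_rw [pow_add, mul_assoc]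
  rw [← Finset.mul_sum, abs_mul, abs_pow, abs_neg, abs_one, one_pow, one_mul, abs_of_nonneg h.1]
  exact h.2

/-- For an alternating series with terms decreasing to zero, `starSum` and the partial sums
divided by the Beta value have the same limiting behaviour. -/
theorem tendsto_starSum_sub_alternating {N a : ℕ} (ha : 1 ≤ a) (hN : 1 ≤ N) {f : ℕ → ℝ}
    (hf : Antitone f) (hpos : ∀ k, 0 ≤ f k) (h0 : Tendsto f atTop (𝓝 0)) :
    Tendsto (fun n => starSum N a (fun k => (-1) ^ k * f k) n -
      1 / ProbabilityTheory.beta ((a : ℝ) / N) ((a : ℝ) / N) *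
        ∑ k ∈ Finset.range (n + 1), (-1) ^ k * f k) atTop (𝓝 0) := by
  obtain ⟨K, hK⟩ := starCoeff_le ha hN
  have hlim := tendsto_starCoeff ha hN
  set L := 1 / ProbabilityTheory.beta ((a : ℝ) / N) ((a : ℝ) / N) with hL
  have hL0 : 0 ≤ L := ge_of_tendsto' (hlim 0) fun n => starCoeff_nonneg ha hN n 0
  -- Cut at p. Both tails are alternating with decreasing terms, so their bound (K+L)f(p) is uniform
  -- in n; the head is a fixed finite sum tending to 0.
  have hbound : ∀ p n, p ≤ n + 1 →
      |starSum N a (fun k => (-1) ^ k * f k) n - L * ∑ k ∈ Finset.range (n + 1), (-1) ^ k * f k| ≤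
        |∑ k ∈ Finset.range p, (starCoeff N a n k - L) * ((-1) ^ k * f k)| + (K + L) * f p := by
    intro p n hp
    have e : starSum N a (fun k => (-1) ^ k * f k) n -
        L * ∑ k ∈ Finset.range (n + 1), (-1) ^ k * f k =
        ∑ k ∈ Finset.range p, (starCoeff N a n k - L) * ((-1) ^ k * f k) +
        (∑ k ∈ Finset.Ico p (n + 1), (-1) ^ k * (starCoeff N a n k * f k) -
          L * ∑ k ∈ Finset.Ico p (n + 1), (-1) ^ k * f k) := by
      unfold starSum
      rw [Finset.mul_sum, ← Finset.sum_sub_distrib, Finset.mul_sum, ← Finset.sum_sub_distrib,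
        ← Finset.sum_range_add_sum_Ico _ hp]
      congr 1 <;> exact Finset.sum_congr rfl fun k _ => by ring
    have h1 := abs_alternating_sum_Ico_le
      (g := fun k => starCoeff N a n k * f k)
      (fun i j h => mul_le_mul (starCoeff_antitone ha hN n h) (hf h) (hpos j)
        (starCoeff_nonneg ha hN n i))
      (fun k => mul_nonneg (starCoeff_nonneg ha hN n k) (hpos k)) p (n + 1)
    have h2 := abs_alternating_sum_Ico_le hf hpos p (n + 1)
    have h3 : starCoeff N a n p * f p ≤ K * f p := mul_le_mul_of_nonneg_right (hK n p) (hpos p)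
    have h4 := mul_le_mul_of_nonneg_left h2 hL0
    rw [e]
    refine (abs_add_le _ _).trans (add_le_add le_rfl ((abs_sub _ _).trans ?_))
    rw [abs_mul, abs_of_nonneg hL0]
    linarith
  rw [Metric.tendsto_atTop]
  intro ε hε
  have hf' : Tendsto (fun p => (K + L) * f p) atTop (𝓝 0) := by simpa using h0.const_mul (K + L)
  obtain ⟨p, hp⟩ := (hf'.eventually (gt_mem_nhds (half_pos hε))).exists
  have hs : Tendsto (fun n => |∑ k ∈ Finset.range p, (starCoeff N a n k - L) * ((-1) ^ k * f k)|)
      atTop (𝓝 0) := by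
    have : Tendsto (fun n => ∑ k ∈ Finset.range p, (starCoeff N a n k - L) * ((-1) ^ k * f k))
        atTop (𝓝 (∑ k ∈ Finset.range p, (L - L) * ((-1) ^ k * f k))) :=
      tendsto_finsetSum _ fun k _ => ((hlim k).sub_const L).mul_const _
    simpa using this.abs
  obtain ⟨n₀, hn₀⟩ := eventually_atTop.1 (hs.eventually (gt_mem_nhds (half_pos hε)))
  refine ⟨max n₀ p, fun n hn => ?_⟩
  rw [Real.dist_eq, sub_zero]
  have h1 := hn₀ n (le_trans (le_max_left _ _) hn)
  have h2 := hbound p n (le_trans (le_max_right _ _) (hn.trans (Nat.le_succ n)))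
  linarith

/-- Euler's product shows that the ratio is O(k^(2α-2)), and the exponent is negative because α < 1.
-/
theorem tendsto_risingRatio {N a : ℕ} (ha : 1 ≤ a) (haN : a < N) :
    Tendsto (risingRatio N a) atTop (𝓝 0) := by
  have hN : 1 ≤ N := ha.trans haN.le
  have hN' : (0 : ℝ) < N := by exact_mod_cast hN
  have ha' : (0 : ℝ) < a := by exact_mod_cast ha
  have hs : 2 * (a : ℝ) / N < 2 := by
    rw [div_lt_iff₀ hN']
    have : (a : ℝ) < N := by exact_mod_cast haN
    linarith
  have hG : 0 < Real.Gamma (2 * (a : ℝ) / N) := Real.Gamma_pos_of_pos (by positivity)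
  have h1 : Tendsto (fun k : ℕ => (k : ℝ) ^ (-(2 - 2 * (a : ℝ) / N))) atTop (𝓝 0) :=
    (tendsto_rpow_neg_atTop (by linarith)).comp tendsto_natCast_atTop_atTop
  have h2 := h1.div (Real.GammaSeq_tendsto_Gamma (2 * (a : ℝ) / N)) hG.ne'
  rw [zero_div] at h2
  refine tendsto_of_tendsto_of_tendsto_of_le_of_le' tendsto_const_nhds h2
    (Eventually.of_forall fun k => (risingRatio_pos ha hN k).le) ?_
  filter_upwards [eventually_gt_atTop 0] with k hk
  have hk' : (0 : ℝ) < k := by exact_mod_cast hk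
  have p := risingTwo_pos ha hN k
  have hf : (0 : ℝ) < (k.factorial : ℝ) := by exact_mod_cast k.factorial_pos
  have hl := lin_pos N ha k
  have hq : 0 < (k : ℝ) ^ (2 * (a : ℝ) / N) := Real.rpow_pos_of_pos hk' _
  have e : Real.GammaSeq (2 * (a : ℝ) / N) k =
      (k : ℝ) ^ (2 * (a : ℝ) / N) * k.factorial / (risingTwo N a k * (2 * a / N + k)) := by
    unfold Real.GammaSeq
    rw [prod_range_add_natCast, ascPochhammer_succ_eval]
    rfl
  have hkl : (k : ℝ) ≤ lin N a k := by linarith [succ_le_lin ha hN k]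
  have hks : (k : ℝ) ≤ 2 * a / N + k := by
    have : (0 : ℝ) < 2 * a / N := by positivity
    linarith
  have e2 : (k : ℝ) ^ (-(2 - 2 * (a : ℝ) / N)) = (k : ℝ) ^ (2 * (a : ℝ) / N) / k ^ 2 := by
    rw [← Real.rpow_natCast, ← Real.rpow_sub hk']
    congr 1
    push_cast
    ring
  rw [Pi.div_apply, e, e2]
  have e3 : (k : ℝ) ^ (2 * (a : ℝ) / N) / k ^ 2 /
      ((k : ℝ) ^ (2 * (a : ℝ) / N) * k.factorial / (risingTwo N a k * (2 * a / N + k))) =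
      risingTwo N a k / k.factorial * ((2 * a / N + k) / k ^ 2) := by
    field_simp
  have e4 : risingRatio N a k = risingTwo N a k / k.factorial * (1 / lin N a k) := by
    unfold risingRatio
    field_simp
  rw [e3, e4]
  refine mul_le_mul_of_nonneg_left ?_ (by positivity)
  rw [div_le_div_iff₀ hl (by positivity), one_mul, sq]
  exact mul_le_mul hks hkl hk'.le (by positivity)

/-! ### Assembly of the evaluation -/

/-- The terms are nonnegative, so convergence along boxes already gives summability; no separate
estimate of the t-star series is needed. -/
theorem summable_tStarTerm_and_tStar_eq {N a : ℕ} (ha : 1 ≤ a) {s : List ℕ} {T : ℝ}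
    (h : Tendsto (tStarFin N a s) atTop (𝓝 T)) :
    Summable (tStarTerm N a s) ∧ tStar N a s = T := by
  obtain ⟨K, hK⟩ := h.bddAbove_range
  have hnn : ∀ k : Fin s.length → ℕ,
      0 ≤ ∏ i, 1 / ((N : ℝ) * (k i : ℝ) + (a : ℝ)) ^ (s.get i) := fun k =>
    Finset.prod_nonneg fun i _ => one_div_nonneg.2 (pow_nonneg (lin_pos N ha (k i)).le _)
  have hs : Summable (tStarTerm N a s) := by
    refine summable_of_antitoneBox_le (K := K)
      (F := fun k => ∏ i, 1 / ((N : ℝ) * (k i : ℝ) + (a : ℝ)) ^ (s.get i)) fun n => ?_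
    simp_rw [abs_of_nonneg (hnn _)]
    exact hK ⟨n, rfl⟩
  exact ⟨hs, tendsto_nhds_unique (tendsto_sum_antitoneBox
    (F := fun k => ∏ i, 1 / ((N : ℝ) * (k i : ℝ) + (a : ℝ)) ^ (s.get i)) hs.hasSum) h⟩

theorem abs_nestedFiber_le (N a d : ℕ) (b : Fin (d + 1) → ℕ) (c : Fin d → ℕ) (k : ℕ) :
    |nestedFiber N a d b c k| ≤ nestedFiberAbs N a d b c k :=
  Finset.abs_sum_le_sum_abs _ _

theorem summable_nestedTerm {N a d : ℕ} {b : Fin (d + 1) → ℕ} {c : Fin d → ℕ}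
    (h : Summable (nestedFiberAbs N a d b c)) :
    Summable fun k : {k : Fin (d + 1) → ℕ // Antitone k} => nestedTerm N a d b c k.1 := by
  refine summable_of_antitoneBox_le (K := ∑' k, nestedFiberAbs N a d b c k) fun n => ?_
  rw [sum_antitoneBox_succ]
  exact h.sum_le_tsum _ fun k _ => nestedFiberAbs_nonneg N a d b c k

/-- The partial sums over `n ≥ k₀ ≥ ⋯ ≥ k_d ≥ 0` converge when `d = b₀ = 0` and `a < N`. -/
theorem tendsto_nestedPartialSum_zero {N a : ℕ} (ha : 1 ≤ a) (haN : a < N) (b : Fin 1 → ℕ)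
    (hb : b 0 = 0) (c : Fin 0 → ℕ) :
    Tendsto (nestedPartialSum N a 0 b c) atTop
      (𝓝 (ProbabilityTheory.beta ((a : ℝ) / N) ((a : ℝ) / N) / N)) := by
  have hN : 1 ≤ N := ha.trans haN.le
  have hN' : (0 : ℝ) < N := by exact_mod_cast hN
  have ha' : (0 : ℝ) < a := by exact_mod_cast ha
  have hB : 0 < ProbabilityTheory.beta ((a : ℝ) / N) ((a : ℝ) / N) :=
    ProbabilityTheory.beta_pos (by positivity) (by positivity)
  set B := ProbabilityTheory.beta ((a : ℝ) / N) ((a : ℝ) / N) with hBdef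
  have h := tendsto_starSum_sub_alternating ha hN (f := fun k => 2 * N * risingRatio N a k)
    (fun i j hij => mul_le_mul_of_nonneg_left (risingRatio_antitone ha haN.le hij) (by positivity))
    (fun k => by have := risingRatio_pos ha hN k; positivity)
    (by simpa using (tendsto_risingRatio ha haN).const_mul (2 * (N : ℝ)))
  have h1 : (fun k => (-1) ^ k * (2 * N * risingRatio N a k)) = unitWeight N a := by
    funext k
    unfold unitWeight risingRatio
    ring
  have h2 : ∀ n, ∑ k ∈ Finset.range (n + 1), (-1) ^ k * (2 * N * risingRatio N a k) =
      N * nestedPartialSum N a 0 b c n := by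
    intro n
    rw [nestedPartialSum_eq, sum_antitoneBox_nestedTerm, Finset.mul_sum]
    refine Finset.sum_congr rfl fun k _ => ?_
    rw [nestedFiber_zero, hb, mul_zero, pow_zero, div_one]
    unfold risingRatio
    ring
  simp_rw [h2] at h
  rw [h1] at h
  simp_rw [starSum_unitWeight ha hN, ← hBdef] at h
  -- Since the transform is constantly 1, `h` says 1 - (N/B)·(partial sum) → 0; this solves for the
  -- partial sum.
  have h3 := ((tendsto_const_nhds (x := (1 : ℝ))).sub h).mul_const (B / N)
  rw [sub_zero, one_mul] at h3
  refine h3.congr fun n => ?_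
  field_simp
  ring

end

end LevelTStar

theorem mainTheorem4 (N a : ℕ) (ha : 1 ≤ a) (haN : a ≤ N) (d : ℕ)
    (b : Fin (d + 1) → ℕ) (c : Fin d → ℕ)
    (hc : ∀ i, 1 ≤ c i ∧ c i ≠ 2)
    (hc1 : ∀ hd : 0 < d, b 0 = 0 → 3 ≤ c ⟨0, hd⟩)
    (hedge : ¬ (d = 0 ∧ b 0 = 0 ∧ a = N)) :
    Summable (LevelTStar.tStarTerm N a (LevelTStar.blockIndex d b c)) ∧
    ∃ S : ℝ,
      Tendsto (LevelTStar.nestedPartialSum N a d b c) atTop (𝓝 S) ∧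
      ((1 ≤ d ∨ 1 ≤ b 0) →
        HasSum (fun k : {k : Fin (d + 1) → ℕ // Antitone k} =>
          LevelTStar.nestedTerm N a d b c k.1) S) ∧
      LevelTStar.tStar N a (LevelTStar.blockIndex d b c) =
        (N : ℝ) / ProbabilityTheory.beta ((a : ℝ) / (N : ℝ)) ((a : ℝ) / (N : ℝ)) * S := by
  open LevelTStar in
  have hN : 1 ≤ N := ha.trans haN
  by_cases hdb : 1 ≤ d ∨ 1 ≤ b 0
  · have hsum := summable_nestedFiberAbs ha haN d b c hc hc1 hdb
    have hterm := (summable_nestedTerm hsum).hasSum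
    have hfib : Summable (nestedFiber N a d b c) :=
      Summable.of_norm_bounded hsum (abs_nestedFiber_le N a d b c)
    have hpart := tendsto_sum_antitoneBox (F := nestedTerm N a d b c) hterm
    -- Both sides are limits of the same box sums, so no iterated-sum theorem is required.
    have hS : ∑' k, nestedFiber N a d b c k =
        ∑' k : {k : Fin (d + 1) → ℕ // Antitone k}, nestedTerm N a d b c k.1 := by
      refine tendsto_nhds_unique ?_ hpart
      simp_rw [sum_antitoneBox_nestedTerm]
      exact hfib.hasSum.tendsto_sum_nat.comp (tendsto_add_atTop_nat 1)
    have hlim := tendsto_starSum ha hN (hfib.mul_left (N : ℝ))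
    have hfin : tStarFin N a (blockIndex d b c) =
        starSum N a (fun k => N * nestedFiber N a d b c k) :=
      funext (tStarFin_blockIndex ha hN d b c hc)
    rw [← hfin, tsum_mul_left, hS] at hlim
    obtain ⟨h1, h2⟩ := summable_tStarTerm_and_tStar_eq ha hlim
    refine ⟨h1, _, hpart.congr fun n => (nestedPartialSum_eq N a d b c n).symm,
      fun _ => hterm, h2.trans ?_⟩
    ring
  · obtain ⟨hd, hb⟩ : d = 0 ∧ b 0 = 0 := by omega
    subst hd
    -- For a = N the terms would be 2(-1)^k/N and the partial sums would oscillate.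
    have hlt : a < N := lt_of_le_of_ne haN fun h => hedge ⟨rfl, hb, h⟩
    have hN' : (0 : ℝ) < N := by exact_mod_cast hN
    have ha' : (0 : ℝ) < a := by exact_mod_cast ha
    have hB : 0 < ProbabilityTheory.beta ((a : ℝ) / N) ((a : ℝ) / N) :=
      ProbabilityTheory.beta_pos (by positivity) (by positivity)
    have hnil : blockIndex 0 b c = [] := by simp [blockIndex_zero, hb]
    have hlim : Tendsto (tStarFin N a (blockIndex 0 b c)) atTop (𝓝 1) := by
      rw [hnil]
      exact tendsto_const_nhds.congr fun n => (tStarFin_nil N a n).symm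
    obtain ⟨h1, h2⟩ := summable_tStarTerm_and_tStar_eq ha hlim
    refine ⟨h1, _, tendsto_nestedPartialSum_zero ha hlt b hb c, fun h => absurd h hdb,
      h2.trans ?_⟩
    field_simp
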